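/- Consider the $n\times n$ square grid with its $4n$ external edges (one leaving the grid at each boundary vertex for each side it lies on), numbered cyclically around the square. A fully packed loop (FPL) configuration is a set of occupied edges such that every grid vertex lies on exactly two occupied edges and every other external edge is occupied (closed loops are allowed). Let $a,b,c\ge 1$ be integers with $a+b+c=n$, and let $A,B,C$ be external edges of which $A$ and $B$ are at cyclic distance $2(a+b)$, $B$ and $C$ at distance $2(b+c)$, and $C$ and $A$ at distance $2(c+a)$, all measured in the same direction around the square. An FPL configuration is of type $(A,B,C)$ if $A,B,C$ are unoccupied and its paths form three bundles of $a$, $b$, $c$ nested arches centred at $A$, $B$, $C$: for each $0\le i<a$ the two external edges at distance $2i+1$ on either side of $A$ are occupied and are joined by a path of the configuration, and similarly for $B$ with $0\le i<b$ and for $C$ with $0\le i<c$. A domino consists of two unit squares of the grid sharing an edge, its middle edge; its border is a cycle of six edges, which splits into two triples of alternate edges. A local move applies to a horizontal or vertical domino whose middle edge is occupied and whose occupied border edges are exactly one of these two triples; it replaces this triple by the other one and leaves all other edges (including the middle edge) unchanged. Corollary 1. The local moves are ergodic on the FPL configurations of type $(A,B,C)$: a local move applied to an FPL configuration of type $(A,B,C)$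 yields an FPL configuration of type $(A,B,C)$, and any two FPL configurations of type $(A,B,C)$ can be transformed into each other by a finite sequence of local moves. -/

import Mathlib

/-!
Fully packed loop (FPL) configurations on the `n × n` square grid.

The vertices of the grid are the points of `ℤ × ℤ` with both coordinates in `{1, …, n}`. Each of
the `4 n` external edges joins a grid vertex on the side of the square to its neighbour outside the
square; the outer end points are the points `(i, 0)`, `(i, n + 1)`, `(0, i)`, `(n + 1, i)` with
`1 ≤ i ≤ n`. A configuration is the graph formed by its occupied edges.
-/

namespace FPL

/-- The `n ^ 2` vertices of the grid. -/
def IsGridVertex (n : ℕ) (v : ℤ × ℤ) : Prop :=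
  1 ≤ v.1 ∧ v.1 ≤ n ∧ 1 ≤ v.2 ∧ v.2 ≤ n

/-- The `n × n` grid together with its `4 n` external edges: all the edges of the square lattice
that have at least one end point in the grid. -/
def board (n : ℕ) : SimpleGraph (ℤ × ℤ) where
  Adj u v := |u.1 - v.1| + |u.2 - v.2| = 1 ∧ (IsGridVertex n u ∨ IsGridVertex n v)
  symm := ⟨fun u v h => ⟨by rw [abs_sub_comm v.1, abs_sub_comm v.2]; exact h.1, h.2.symm⟩⟩
  loopless := ⟨fun u h => by simp at h⟩

/-- The outer end point of the external edge number `k`. The `4 n` external edges are numbered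
cyclically, counterclockwise: bottom side from left to right, right side upwards, top side from
right to left, left side downwards. -/
def outer (n : ℕ) (k : ZMod (4 * n)) : ℤ × ℤ :=
  if k.val < n then ((k.val : ℤ) + 1, 0)
  else if k.val < 2 * n then ((n : ℤ) + 1, (k.val : ℤ) - n + 1)
  else if k.val < 3 * n then (3 * (n : ℤ) - k.val, (n : ℤ) + 1)
  else (0, 4 * (n : ℤ) - k.val)

/-- The external edge number `k` is occupied in the configuration `F`. (The external edge is the
only edge of the board at its outer end point.) -/
def Occupied (n : ℕ) (F : SimpleGraph (ℤ × ℤ)) (k : ZMod (4 * n)) : Prop :=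
  ∃ v, F.Adj (outer n k) v

/-- `F` is (the graph of the occupied edges of) an FPL configuration: every grid vertex lies on
exactly two occupied edges, and every other external edge is occupied. Closed loops inside the
grid are allowed. -/
structure IsFPL (n : ℕ) (F : SimpleGraph (ℤ × ℤ)) : Prop where
  le_board : F ≤ board n
  two_edges : ∀ v, IsGridVertex n v → (F.neighborSet v).ncard = 2
  alternating : ∀ k : ZMod (4 * n), Occupied n F (k + 1) ↔ ¬ Occupied n F k

/-- The external edges `k` and `l` are occupied and are the two ends of the same path of `F`. -/
def Linked (n : ℕ) (F : SimpleGraph (ℤ × ℤ)) (k l : ZMod (4 * n)) : Prop :=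
  Occupied n F k ∧ Occupied n F l ∧ k ≠ l ∧ F.Reachable (outer n k) (outer n l)

/-- `F` has a bundle of `r` nested arches with centre the external edge `X`: the occupied external
edges at (odd) distance `2 i + 1` on the two sides of `X` are linked, for `i < r`. -/
def HasNestedArches (n : ℕ) (F : SimpleGraph (ℤ × ℤ)) (X : ZMod (4 * n)) (r : ℕ) : Prop :=
  ∀ i : ℕ, i < r → Linked n F (X + (2 * i + 1 : ℕ)) (X - (2 * i + 1 : ℕ))

/-- The external edges `A`, `B`, `C` are in the position of the centres of three adjacent bundles
of `a`, `b`, `c` nested arches: there are `a + b` occupied external edges between `A` and `B`,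
`b + c` between `B` and `C`, and `c + a` between `C` and `A`, in the counterclockwise or in the
clockwise direction. As every other external edge is occupied, `m` occupied edges between two
unoccupied ones means a distance `2 m`. -/
def AreCentres (n a b c : ℕ) (A B C : ZMod (4 * n)) : Prop :=
  (B = A + (2 * (a + b) : ℕ) ∧ C = B + (2 * (b + c) : ℕ) ∧ A = C + (2 * (c + a) : ℕ)) ∨
  (B = A - (2 * (a + b) : ℕ) ∧ C = B - (2 * (b + c) : ℕ) ∧ A = C - (2 * (c + a) : ℕ))

/-- `F` is an FPL configuration of type `(A, B, C)`, with `a`, `b`, `c` nested arches around the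
unoccupied external edges `A`, `B`, `C`. -/
structure IsOfType (n a b c : ℕ) (A B C : ZMod (4 * n)) (F : SimpleGraph (ℤ × ℤ)) : Prop where
  isFPL : IsFPL n F
  unoccupied_A : ¬ Occupied n F A
  unoccupied_B : ¬ Occupied n F B
  unoccupied_C : ¬ Occupied n F C
  arches_A : HasNestedArches n F A a
  arches_B : HasNestedArches n F B b
  arches_C : HasNestedArches n F C c

/-- The six vertices of the domino made of the two unit squares with corners
`p, p + e, p + f, p + e + f` and `p + f, p + e + f, p + 2 f, p + e + 2 f`. -/
def dominoVertices (p e f : ℤ × ℤ) : Set (ℤ × ℤ) :=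
  {p, p + e, p + f, p + e + f, p + 2 • f, p + e + 2 • f}

/-- The middle edge of the domino, shared by its two squares. -/
def dominoMiddle (p e f : ℤ × ℤ) : Sym2 (ℤ × ℤ) :=
  s(p + f, p + e + f)

/-- One of the two alternating triples of edges of the border of the domino: the short side at `p`
and the two parallel edges, perpendicular to the middle edge, of the other square. -/
def dominoBorder₁ (p e f : ℤ × ℤ) : Set (Sym2 (ℤ × ℤ)) :=
  {s(p, p + e), s(p + f, p + 2 • f), s(p + e + f, p + e + 2 • f)}

/-- The other alternating triple of edges of the border of the domino. -/
def dominoBorder₂ (p e f : ℤ × ℤ) : Set (Sym2 (ℤ × ℤ)) :=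
  {s(p + 2 • f, p + e + 2 • f), s(p, p + f), s(p + e, p + e + f)}

/-- `G` arises from `F` by replacing, in a domino inside the grid whose middle edge is occupied,
the occupied border edges, which are those of the first triple, by those of the second triple. -/
def DominoFlip (n : ℕ) (p e f : ℤ × ℤ) (F G : SimpleGraph (ℤ × ℤ)) : Prop :=
  (∀ v ∈ dominoVertices p e f, IsGridVertex n v) ∧
  dominoMiddle p e f ∈ F.edgeSet ∧
  dominoBorder₁ p e f ⊆ F.edgeSet ∧
  Disjoint (dominoBorder₂ p e f) F.edgeSet ∧
  G.edgeSet = (F.edgeSet \ dominoBorder₁ p e f) ∪ dominoBorder₂ p e f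

/-- The local moves, in both directions, on a domino that is vertical (short sides horizontal) or
horizontal (short sides vertical). -/
def DominoMove (n : ℕ) (F G : SimpleGraph (ℤ × ℤ)) : Prop :=
  ∃ p : ℤ × ℤ,
    (DominoFlip n p (1, 0) (0, 1) F G ∨ DominoFlip n p (1, 0) (0, 1) G F) ∨
    (DominoFlip n p (0, 1) (1, 0) F G ∨ DominoFlip n p (0, 1) (1, 0) G F)

end FPL

/-! Invariance: a flip turns the path segments `a₀ a₁` and `c₀ b₀ b₁ c₁` into `a₀ b₀ b₁ a₁` and `c₀
c₁`. Only the inner vertices `b₀`, `b₁` change their path, so the linked external edges stay linked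
(`PathSwap.reachable`).

Fixed edges: over an arc of the boundary (at most half a turn) without centre, no two external edges
are linked. Hence no path of the triangle above the arc can return to the arc, and by induction
every second edge pointing away from the base is occupied (`ConeIsolated.adj_up_and_descent`). These
edges are common to all configurations of the type.

Ergodicity: a configuration is encoded by a height function on the unit squares, and two
configurations of the same type have equal heights along the boundary. Lowering a peak by two
exchanges the occupied and unoccupied edges of its square; a domino move is two such toggles in
adjacent squares, the second square becoming a peak after the first toggle. Suppose that the height
`h` of `F` exceeds the height `k` of `G` somewhere. Among the squares where it does, those of
maximal `h` are peaks. The diagonals through such a square cut the boundary into four arcs. Two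
opposite edges of the peak are unoccupied, so by the fixed edges two opposite arcs contain a centre
each. The third centre cannot meet both remaining arcs; an empty one forces one of the other two
edges in `F` and in `G`, and `h` exceeds `k` across that edge too. If the square is chosen extremal
in that direction, the neighbour becomes a peak after the first toggle, and a domino move lowers `h`
in both squares (`canLower`). Lowering whichever height is larger decreases the sum of `|h - k|`
until the configurations agree; moves made at the `G` end are read backwards. -/

namespace FPL
open SimpleGraph

/-! ### Graphs of degree at most two and the rerouting of two path segments -/

section Graph
variable {V : Type*} {F G : SimpleGraph V}

/-- No vertex has three distinct neighbours. -/
def DegLeTwo (F : SimpleGraph V) : Prop :=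
  ∀ v a b c, F.Adj v a → F.Adj v b → F.Adj v c → a ≠ b → a ≠ c → b = c

/-- The vertex has at most one neighbour. -/
def IsLeaf (F : SimpleGraph V) (v : V) : Prop :=
  ∀ a b, F.Adj v a → F.Adj v b → a = b

/-- The vertex `u`, from which both walks have just come, uses up one of the two edges at `z`, so
the next step is forced. -/
theorem DegLeTwo.path_unique_aux (hF : DegLeTwo F) {z w : V} (p q : F.Walk z w) :
    ∀ u, F.Adj u z → p.IsPath → q.IsPath → u ∉ p.support → u ∉ q.support → p = q := by
  induction p with
  | nil =>
    intro u _ _ hq _ _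
    cases q with
    | nil => rfl
    | cons h q => simp at hq
  | cons h p ih =>
    intro u hu hp hq hup huq
    cases q with
    | nil => simp at hp
    | cons h' q =>
      simp only [Walk.cons_isPath_iff, Walk.support_cons, List.mem_cons, not_or] at *
      have := hF _ u _ _ hu.symm h h' (by rintro rfl; exact hup.2 p.start_mem_support)
        (by rintro rfl; exact huq.2 q.start_mem_support)
      subst this
      rw [ih q _ h hp.1 hq.1 hp.2 hq.2]

/-- The same forced walk, now with free ends: if one path stops at a leaf, the edge back to `u` is
the only edge there, so the other path stops as well. -/
theorem DegLeTwo.leaf_unique_aux (hF : DegLeTwo F) {z v w : V} (p : F.Walk z v) :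
    ∀ (u : V) (q : F.Walk z w), IsLeaf F v → IsLeaf F w → F.Adj u z → p.IsPath → q.IsPath →
      u ∉ p.support → u ∉ q.support → v = w := by
  induction p with
  | nil =>
    intro u q hv _ hu _ _ _ huq
    cases q with
    | nil => rfl
    | cons h q =>
      exfalso
      have := hv _ _ hu.symm h
      subst this
      simp at huq
  | cons h p ih =>
    intro u q hv hw hu hp hq hup huq
    cases q with
    | nil =>
      exfalso
      have := hw _ _ hu.symm h
      subst this
      simp at hup
    | cons h' q =>
      simp only [Walk.cons_isPath_iff, Walk.support_cons, List.mem_cons, not_or] at *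
      have := hF _ u _ _ hu.symm h h' (by rintro rfl; exact hup.2 p.start_mem_support)
        (by rintro rfl; exact huq.2 q.start_mem_support)
      subst this
      exact ih _ q hv hw h hp.1 hq.1 hp.2 hq.2

/-- A path component has only one leaf besides a given one. -/
theorem DegLeTwo.leaf_unique (hF : DegLeTwo F) {u v w : V} (hu : IsLeaf F u) (hv : IsLeaf F v)
    (hw : IsLeaf F w) (huv : u ≠ v) (huw : u ≠ w) (h₁ : F.Reachable u v) (h₂ : F.Reachable u w) :
    v = w := by
  obtain ⟨p, hp⟩ := h₁.exists_isPath
  obtain ⟨q, hq⟩ := h₂.exists_isPath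
  cases p with
  | nil => exact absurd rfl huv
  | cons h p =>
    cases q with
    | nil => exact absurd rfl huw
    | cons h' q =>
      have := hu _ _ h h'
      subst this
      rw [Walk.cons_isPath_iff] at hp hq
      exact hF.leaf_unique_aux p _ q hv hw h hp.1 hq.1 hp.2 hq.2

/-- There is at most one path to a leaf. -/
theorem DegLeTwo.path_unique (hF : DegLeTwo F) {u v : V} (hv : IsLeaf F v) (p q : F.Walk u v)
    (hp : p.IsPath) (hq : q.IsPath) : p = q := by
  -- Reversed, the paths start at the leaf, where the first step is forced.
  rw [← Walk.reverse_reverse p, ← Walk.reverse_reverse q]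
  congr 1
  rw [← Walk.isPath_reverse_iff] at hp hq
  generalize p.reverse = p' at hp
  generalize q.reverse = q' at hq
  cases p' with
  | nil =>
    cases q' with
    | nil => rfl
    | cons h q => simp at hq
  | cons h p =>
    cases q' with
    | nil => simp at hp
    | cons h' q =>
      have := hv _ _ h h'
      subst this
      rw [Walk.cons_isPath_iff] at hp hq
      rw [hF.path_unique_aux p q _ h hp.1 hq.1 hp.2 hq.2]

/-- The move that turns the paths `a₀ a₁` and `c₀ b₀ b₁ c₁` into `a₀ b₀ b₁ a₁` and `c₀ c₁`. -/
structure PathSwap (F G : SimpleGraph V) (a₀ a₁ b₀ b₁ c₀ c₁ : V) : Prop where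
  nodup : [a₀, a₁, b₀, b₁, c₀, c₁].Nodup
  mid : F.Adj b₀ b₁
  a : F.Adj a₀ a₁
  bc₀ : F.Adj b₀ c₀
  bc₁ : F.Adj b₁ c₁
  ab₀ : ¬ F.Adj a₀ b₀
  ab₁ : ¬ F.Adj a₁ b₁
  c : ¬ F.Adj c₀ c₁
  adj : ∀ u v, G.Adj u v ↔
    F.Adj u v ∧ s(u, v) ∉ ({s(a₀, a₁), s(b₀, c₀), s(b₁, c₁)} : Set (Sym2 V)) ∨
    s(u, v) ∈ ({s(c₀, c₁), s(a₀, b₀), s(a₁, b₁)} : Set (Sym2 V))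

/-- Each of the six vertices loses one edge and gains one; all others keep theirs. -/
theorem PathSwap.ncard_neighborSet {a₀ a₁ b₀ b₁ c₀ c₁ : V} (h : PathSwap F G a₀ a₁ b₀ b₁ c₀ c₁)
    (v : V) : (G.neighborSet v).ncard = (F.neighborSet v).ncard := by
  obtain ⟨nd, mid, ha, hb₀, hb₁, hab₀, hab₁, hc, adj⟩ := h
  simp only [List.nodup_cons, List.mem_cons, List.not_mem_nil, or_false, not_or] at nd
  have key : ∀ x y, F.Adj v x → ¬ F.Adj v y →
      (∀ w, G.Adj v w ↔ F.Adj v w ∧ w ≠ x ∨ w = y) →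
      (G.neighborSet v).ncard = (F.neighborSet v).ncard := by
    intro x y hx hy hw
    rw [← Set.ncard_exchange (s := F.neighborSet v) (a := y) (b := x) hy hx]
    congr 1
    ext w
    simp [hw, or_comm]
  have sy := fun u v => F.adj_comm u v
  by_cases h1 : v = a₀
  · subst h1
    refine key a₁ b₀ ha hab₀ fun w => ?_
    rw [adj]; simp only [Set.mem_insert_iff, Set.mem_singleton_iff, Sym2.eq_iff]; grind
  by_cases h2 : v = a₁
  · subst h2
    refine key a₀ b₁ ha.symm hab₁ fun w => ?_
    rw [adj]; simp only [Set.mem_insert_iff, Set.mem_singleton_iff, Sym2.eq_iff]; grind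
  by_cases h3 : v = b₀
  · subst h3
    refine key c₀ a₀ hb₀ (fun h => hab₀ h.symm) fun w => ?_
    rw [adj]; simp only [Set.mem_insert_iff, Set.mem_singleton_iff, Sym2.eq_iff]; grind
  by_cases h4 : v = b₁
  · subst h4
    refine key c₁ a₁ hb₁ (fun h => hab₁ h.symm) fun w => ?_
    rw [adj]; simp only [Set.mem_insert_iff, Set.mem_singleton_iff, Sym2.eq_iff]; grind
  by_cases h5 : v = c₀
  · subst h5
    refine key b₀ c₁ hb₀.symm hc fun w => ?_
    rw [adj]; simp only [Set.mem_insert_iff, Set.mem_singleton_iff, Sym2.eq_iff]; grind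
  by_cases h6 : v = c₁
  · subst h6
    refine key b₁ c₀ hb₁.symm (fun h => hc h.symm) fun w => ?_
    rw [adj]; simp only [Set.mem_insert_iff, Set.mem_singleton_iff, Sym2.eq_iff]; grind
  congr 1
  ext w
  rw [mem_neighborSet, mem_neighborSet, adj]
  simp only [Set.mem_insert_iff, Set.mem_singleton_iff, Sym2.eq_iff]; grind

theorem PathSwap.reachable {a₀ a₁ b₀ b₁ c₀ c₁ : V} (h : PathSwap F G a₀ a₁ b₀ b₁ c₀ c₁)
    (h₀ : (F.neighborSet b₀).ncard = 2) (h₁ : (F.neighborSet b₁).ncard = 2) {u v : V}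
    (hu₀ : u ≠ b₀) (hu₁ : u ≠ b₁) (hv₀ : v ≠ b₀) (hv₁ : v ≠ b₁) (huv : F.Reachable u v) :
    G.Reachable u v := by
  classical
  obtain ⟨nd, mid, ha, hb₀, hb₁, hab₀, hab₁, hc, adj⟩ := h
  simp only [List.nodup_cons, List.mem_cons, List.not_mem_nil, or_false, not_or] at nd
  have two : ∀ {b x y : V}, (F.neighborSet b).ncard = 2 → F.Adj b x → F.Adj b y → x ≠ y →
      ∀ w, F.Adj b w → w = x ∨ w = y := by
    intro b x y hb hx hy hxy w hw
    have hfin := Set.finite_of_ncard_ne_zero (s := F.neighborSet b) (by omega)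
    have := Set.eq_of_subset_of_ncard_le (s := {x, y}) (t := F.neighborSet b)
      (by rintro z (rfl | rfl) <;> assumption) (by rw [hb, Set.ncard_pair hxy]) hfin
    have hw' : w ∈ F.neighborSet b := hw
    rw [← this] at hw'
    exact hw'
  have t₀ := two h₀ mid hb₀ (by tauto)
  have t₁ := two h₁ mid.symm hb₁ (by tauto)
  have g : ∀ {x y : V}, s(x, y) ∈ ({s(c₀, c₁), s(a₀, b₀), s(a₁, b₁)} : Set (Sym2 V)) →
      G.Adj x y := fun h => (adj _ _).2 (Or.inr h)
  have gm : G.Adj b₀ b₁ := (adj _ _).2 (Or.inl ⟨mid, by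
    simp only [Set.mem_insert_iff, Set.mem_singleton_iff, Sym2.eq_iff]; grind⟩)
  have gc : G.Adj c₀ c₁ := g (by simp)
  have ga : G.Reachable a₀ a₁ :=
    ((g (x := a₀) (y := b₀) (by simp)).reachable.trans gm.reachable).trans
      (g (x := a₁) (y := b₁) (by simp)).symm.reachable
  let φ : V → V := fun x => if x = b₀ then c₀ else if x = b₁ then c₁ else x
  have hφ : ∀ x y, F.Adj x y → G.Reachable (φ x) (φ y) := by
    intro x y hxy
    by_cases hx₀ : x = b₀
    · subst hx₀
      rcases t₀ y hxy with rfl | rfl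
      · simpa [φ, Ne.symm, nd, mid.ne'] using gc.reachable
      · have : y ≠ b₁ := by tauto
        have : y ≠ x := by tauto
        simp [φ, *]
    by_cases hx₁ : x = b₁
    · subst hx₁
      rcases t₁ y hxy with rfl | rfl
      · simpa [φ, nd, mid.ne'] using gc.symm.reachable
      · have : y ≠ b₀ := by tauto
        have : y ≠ x := by tauto
        simp [φ, *]
    by_cases hy₀ : y = b₀
    · subst hy₀
      rcases t₀ x hxy.symm with rfl | rfl
      · exact absurd rfl hx₁
      · simp [φ, *]
    by_cases hy₁ : y = b₁
    · subst hy₁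
      rcases t₁ x hxy.symm with rfl | rfl
      · exact absurd rfl hx₀
      · simp [φ, *]
    simp only [φ, if_neg hx₀, if_neg hx₁, if_neg hy₀, if_neg hy₁]
    by_cases hh : s(x, y) = s(a₀, a₁)
    · rcases Sym2.eq_iff.1 hh with ⟨rfl, rfl⟩ | ⟨rfl, rfl⟩
      · exact ga
      · exact ga.symm
    · refine ((adj _ _).2 (Or.inl ⟨hxy, ?_⟩)).reachable
      simp only [Set.mem_insert_iff, Set.mem_singleton_iff, Sym2.eq_iff] at hh ⊢; grind
  have main : ∀ {x y : V}, F.Reachable x y → G.Reachable (φ x) (φ y) := by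
    rintro x y ⟨p⟩
    induction p with
    | nil => exact Reachable.refl _
    | cons h _ ih => exact (hφ _ _ h).trans ih
  simpa [φ, hu₀, hu₁, hv₀, hv₁] using main huv

end Graph

/-! ### Local moves preserve the type -/

/-- Two perpendicular unit vectors of the lattice. -/
def Frame (e f : ℤ × ℤ) : Prop :=
  (e.2 = 0 ∧ f.1 = 0 ∧ (e.1 = 1 ∨ e.1 = -1) ∧ (f.2 = 1 ∨ f.2 = -1)) ∨
  (e.1 = 0 ∧ f.2 = 0 ∧ (e.2 = 1 ∨ e.2 = -1) ∧ (f.1 = 1 ∨ f.1 = -1))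

theorem mem_dominoVertices {p e f v : ℤ × ℤ} : v ∈ dominoVertices p e f ↔
    v = p ∨ v = p + e ∨ v = p + f ∨ v = p + e + f ∨ v = p + 2 • f ∨ v = p + e + 2 • f := by
  simp [dominoVertices]

theorem Frame.nodup {e f : ℤ × ℤ} (h : Frame e f) (p : ℤ × ℤ) :
    [p, p + e, p + f, p + e + f, p + 2 • f, p + e + 2 • f].Nodup := by
  obtain ⟨p₁, p₂⟩ := p
  obtain ⟨e₁, e₂⟩ := e
  obtain ⟨f₁, f₂⟩ := f
  simp only [Frame] at h
  simp only [List.nodup_cons, List.mem_cons, List.not_mem_nil, or_false, not_or, Prod.mk_add_mk,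
    Prod.smul_mk, Prod.mk.injEq, not_and_or, nsmul_eq_mul, Nat.cast_ofNat,
    List.nodup_nil, and_true, not_false_eq_true]
  omega

theorem DominoFlip.pathSwap {n : ℕ} {p e f : ℤ × ℤ} {F G : SimpleGraph (ℤ × ℤ)}
    (hef : Frame e f) (h : DominoFlip n p e f F G) :
    PathSwap F G p (p + e) (p + f) (p + e + f) (p + 2 • f) (p + e + 2 • f) := by
  obtain ⟨-, hm, h₁, h₂, hG⟩ := h
  have h₂' : ∀ x ∈ dominoBorder₂ p e f, x ∉ F.edgeSet := fun x hx => Set.disjoint_left.1 h₂ hx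
  refine ⟨hef.nodup p, hm, h₁ (Or.inl rfl), h₁ (Or.inr (Or.inl rfl)),
    h₁ (Or.inr (Or.inr rfl)), h₂' s(_, _) (Or.inr (Or.inl rfl)),
    h₂' s(_, _) (Or.inr (Or.inr rfl)), h₂' s(_, _) (Or.inl rfl), fun u v => ?_⟩
  rw [← mem_edgeSet, hG]
  rfl

/-- A flipped domino, turned by a half turn, can be flipped back. -/
theorem DominoFlip.reverse {n : ℕ} {p e f : ℤ × ℤ} {F G : SimpleGraph (ℤ × ℤ)}
    (hef : Frame e f) (h : DominoFlip n p e f F G) :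
    DominoFlip n (p + e + 2 • f) (-e) (-f) G F := by
  have hs := h.pathSwap hef
  obtain ⟨hv, hm, h₁, h₂, hG⟩ := h
  have e0 : p + e + 2 • f + -e = p + 2 • f := by abel
  have e1 : p + e + 2 • f + -f = p + e + f := by abel
  have e2 : p + e + 2 • f + -e + -f = p + f := by abel
  have e3 : p + e + 2 • f + 2 • -f = p + e := by abel
  have e4 : p + e + 2 • f + -e + 2 • -f = p := by abel
  have b₁ : dominoBorder₁ (p + e + 2 • f) (-e) (-f) = dominoBorder₂ p e f := by
    simp only [dominoBorder₁, dominoBorder₂, e1, e2, e3, e4]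
    rw [e0, Sym2.eq_swap, Sym2.eq_swap (a := p + e + f), Sym2.eq_swap (a := p + f)]
    congr 1
    exact Set.pair_comm _ _
  have b₂ : dominoBorder₂ (p + e + 2 • f) (-e) (-f) = dominoBorder₁ p e f := by
    simp only [dominoBorder₁, dominoBorder₂, e1, e2, e3, e4]
    rw [e0, Sym2.eq_swap, Sym2.eq_swap (a := p + e + 2 • f), Sym2.eq_swap (a := p + 2 • f)]
    congr 1
    exact Set.pair_comm _ _
  have m : dominoMiddle (p + e + 2 • f) (-e) (-f) = dominoMiddle p e f := by
    simp only [dominoMiddle, e1, e2]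
    exact Sym2.eq_swap
  have hnd := hs.nodup
  simp only [List.nodup_cons, List.mem_cons, List.not_mem_nil, or_false, not_or] at hnd
  have hd : Disjoint (dominoBorder₁ p e f) (dominoBorder₂ p e f) :=
    Set.disjoint_left.2 fun x hx hx' => Set.disjoint_left.1 h₂ hx' (h₁ hx)
  refine ⟨?_, ?_, ?_, ?_, ?_⟩
  · intro v hv'
    apply hv
    rw [mem_dominoVertices, e1, e2, e3, e4, e0] at hv'
    rw [mem_dominoVertices]
    tauto
  · rw [m, hG]
    refine Or.inl ⟨hm, ?_⟩
    simp only [dominoMiddle, dominoBorder₁, Set.mem_insert_iff, Set.mem_singleton_iff, Sym2.eq_iff]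
    grind
  · rw [b₁, hG]
    exact Set.subset_union_right
  · rw [b₂, hG, Set.disjoint_union_right]
    exact ⟨Set.disjoint_sdiff_right, hd⟩
  · rw [b₁, b₂, hG, Set.union_sdiff_right]
    ext x
    simp only [Set.mem_union, Set.mem_sdiff]
    have := @h₁ x
    have h₂' := fun hx : x ∈ dominoBorder₂ p e f => Set.disjoint_left.1 h₂ hx
    by_cases x ∈ F.edgeSet <;> by_cases x ∈ dominoBorder₁ p e f <;> simp_all

theorem not_isGridVertex_outer (n : ℕ) (k : ZMod (4 * n)) : ¬ IsGridVertex n (outer n k) := by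
  unfold outer IsGridVertex
  split_ifs <;> simp

theorem DominoFlip.adj_outer_iff {n : ℕ} {p e f : ℤ × ℤ} {F G : SimpleGraph (ℤ × ℤ)}
    (hef : Frame e f) (h : DominoFlip n p e f F G) {o : ℤ × ℤ} (ho : ¬ IsGridVertex n o)
    (v : ℤ × ℤ) : G.Adj o v ↔ F.Adj o v := by
  have hv := h.1
  have : ∀ w ∈ dominoVertices p e f, o ≠ w := fun w hw h' => ho (h' ▸ hv w hw)
  simp only [mem_dominoVertices, forall_eq_or_imp, forall_eq] at this
  rw [(h.pathSwap hef).adj]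
  simp only [Set.mem_insert_iff, Set.mem_singleton_iff, Sym2.eq_iff]
  tauto

/-- The domino lies inside the grid, so external edges are untouched; its two middle vertices have
degree two, which is what the rerouting of paths requires. -/
theorem DominoFlip.isOfType {n a b c : ℕ} {A B C : ZMod (4 * n)} {p e f : ℤ × ℤ}
    {F G : SimpleGraph (ℤ × ℤ)} (hef : Frame e f) (h : DominoFlip n p e f F G)
    (hF : IsOfType n a b c A B C F) : IsOfType n a b c A B C G := by
  have hs := h.pathSwap hef
  have hocc : ∀ k, Occupied n G k ↔ Occupied n F k := fun k =>
    exists_congr fun v => h.adj_outer_iff hef (not_isGridVertex_outer n k) v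
  have hlink : ∀ k l, Linked n F k l → Linked n G k l := by
    rintro k l ⟨hk, hl, hkl, hr⟩
    have hne : ∀ k, ∀ w ∈ dominoVertices p e f, outer n k ≠ w := fun k w hw h' =>
      not_isGridVertex_outer n k (h' ▸ h.1 w hw)
    refine ⟨(hocc k).2 hk, (hocc l).2 hl, hkl, hs.reachable ?_ ?_ ?_ ?_ ?_ ?_ hr⟩
    · exact hF.isFPL.two_edges _ (h.1 _ (by simp [dominoVertices]))
    · exact hF.isFPL.two_edges _ (h.1 _ (by simp [dominoVertices]))
    all_goals exact hne _ _ (by simp [dominoVertices])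
  refine ⟨⟨?_, ?_, ?_⟩, ?_, ?_, ?_, ?_, ?_, ?_⟩
  · intro u v huv
    rw [hs.adj] at huv
    rcases huv with huv | huv
    · exact hF.isFPL.le_board huv.1
    · have hgv := h.1
      simp only [mem_dominoVertices, forall_eq_or_imp, forall_eq] at hgv
      obtain ⟨g1, g2, g3, g4, g5, g6⟩ := hgv
      have hadj : ∀ x y : ℤ × ℤ, IsGridVertex n x → |x.1 - y.1| + |x.2 - y.2| = 1 →
          (board n).Adj x y := fun x y hx hxy => ⟨hxy, Or.inl hx⟩
      have unit : ∀ d : ℤ × ℤ, Frame d f ∨ Frame e d → |d.1| + |d.2| = 1 := by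
        rintro ⟨d₁, d₂⟩ hd
        simp only [Frame] at hd ⊢
        rcases hd with (hd | hd) | (hd | hd) <;> obtain ⟨h1, h2, h3, h4⟩ := hd <;>
          rcases h3 with h3 | h3 <;> rcases h4 with h4 | h4 <;> simp [h1, h2, h3, h4]
      have ue := unit e (Or.inl hef)
      have uf := unit f (Or.inr hef)
      simp only [Set.mem_insert_iff, Set.mem_singleton_iff] at huv
      rw [← mem_edgeSet]
      rcases huv with huv | huv | huv <;> rw [huv, mem_edgeSet]
      · refine (hadj _ _ g6 ?_).symm
        simpa [add_sub_add_right_eq_sub] using ue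
      · refine (hadj _ _ g3 ?_).symm
        simpa using uf
      · refine (hadj _ _ g4 ?_).symm
        simpa using uf
  · intro v hv
    rw [hs.ncard_neighborSet]
    exact hF.isFPL.two_edges v hv
  · intro k
    rw [hocc, hocc]
    exact hF.isFPL.alternating k
  · rw [hocc]; exact hF.unoccupied_A
  · rw [hocc]; exact hF.unoccupied_B
  · rw [hocc]; exact hF.unoccupied_C
  · exact fun i hi => hlink _ _ (hF.arches_A i hi)
  · exact fun i hi => hlink _ _ (hF.arches_B i hi)
  · exact fun i hi => hlink _ _ (hF.arches_C i hi)

/-- A flip read backwards is a flip of the domino after a half turn. This is why `Frame` admits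
negative unit vectors. -/
theorem DominoMove.isOfType {n a b c : ℕ} {A B C : ZMod (4 * n)} {F G : SimpleGraph (ℤ × ℤ)}
    (h : DominoMove n F G) (hF : IsOfType n a b c A B C F) : IsOfType n a b c A B C G := by
  have f₁ : Frame (1, 0) (0, 1) := by simp [Frame]
  have f₂ : Frame (0, 1) (1, 0) := by simp [Frame]
  have f₃ : Frame (-(1, 0)) (-(0, 1)) := by simp [Frame]
  have f₄ : Frame (-(0, 1)) (-(1, 0)) := by simp [Frame]
  obtain ⟨p, (h | h) | (h | h)⟩ := h
  · exact h.isOfType f₁ hF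
  · exact (h.reverse f₁).isOfType f₃ hF
  · exact h.isOfType f₂ hF
  · exact (h.reverse f₂).isOfType f₄ hF

theorem DominoMove.symm {n : ℕ} {F G : SimpleGraph (ℤ × ℤ)} (h : DominoMove n F G) :
    DominoMove n G F :=
  let ⟨p, hp⟩ := h
  ⟨p, hp.imp Or.symm Or.symm⟩

/-! ### Forced edges in a triangle over the boundary -/

theorem board_adj {n : ℕ} {u v : ℤ × ℤ} (h : (board n).Adj u v) :
    (IsGridVertex n u ∨ IsGridVertex n v) ∧
    ((v.1 = u.1 + 1 ∧ v.2 = u.2) ∨ (v.1 = u.1 - 1 ∧ v.2 = u.2) ∨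
      (v.1 = u.1 ∧ v.2 = u.2 + 1) ∨ (v.1 = u.1 ∧ v.2 = u.2 - 1)) := by
  refine ⟨h.2, ?_⟩
  have h1 := h.1
  rcases abs_cases (u.1 - v.1) with ⟨h2, h3⟩ | ⟨h2, h3⟩ <;>
    rcases abs_cases (u.2 - v.2) with ⟨h4, h5⟩ | ⟨h4, h5⟩ <;> omega

theorem isLeaf_of_le_board {n : ℕ} {F : SimpleGraph (ℤ × ℤ)} (hF : F ≤ board n) {o : ℤ × ℤ}
    (ho : ¬ IsGridVertex n o) : IsLeaf F o := by
  intro a b ha hb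
  have h1 := board_adj (hF ha)
  have h2 := board_adj (hF hb)
  simp only [IsGridVertex] at *
  apply Prod.ext <;> omega

theorem degLeTwo_of_two_edges {n : ℕ} {F : SimpleGraph (ℤ × ℤ)} (hF : F ≤ board n)
    (h2 : ∀ v, IsGridVertex n v → (F.neighborSet v).ncard = 2) : DegLeTwo F := by
  intro v a b c ha hb hc hab hac
  by_cases hv : IsGridVertex n v
  · obtain ⟨x, y, -, hxy⟩ := Set.ncard_eq_two.1 (h2 v hv)
    have key : ∀ w, F.Adj v w → w = x ∨ w = y := fun w hw => by
      have : w ∈ F.neighborSet v := hw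
      rwa [hxy] at this
    have := key a ha
    have := key b hb
    have := key c hc
    grind
  · exact isLeaf_of_le_board hF hv _ _ hb hc

/-- No two outer points in the cone below `(x, y)` are ends of the same path. -/
def ConeIsolated (n : ℕ) (F : SimpleGraph (ℤ × ℤ)) (x y : ℤ) : Prop :=
  ∀ o o' : ℤ × ℤ, ¬ IsGridVertex n o → ¬ IsGridVertex n o' → (∃ v, F.Adj o v) →
    (∃ v, F.Adj o' v) → o.1 - x + o.2 ≤ y + 1 → x - o.1 + o.2 ≤ y + 1 →
    o'.1 - x + o'.2 ≤ y + 1 → x - o'.1 + o'.2 ≤ y + 1 → F.Reachable o o' → o = o'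

/-- In a triangle based on the bottom side and on external edges of which no two are linked,
every other vertical edge is occupied, and the paths run downwards to the base. -/
theorem ConeIsolated.adj_up_and_descent {n : ℕ} {α : ℤ} {F : SimpleGraph (ℤ × ℤ)}
    (hF : F ≤ board n) (h2 : ∀ v, IsGridVertex n v → (F.neighborSet v).ncard = 2)
    (hbot : ∀ x : ℤ, 1 ≤ x → x ≤ n → (x + α) % 2 = 0 → F.Adj (x, 1) (x, 0)) (m : ℕ) :
    ∀ x y : ℤ, y ≤ m → IsGridVertex n (x, y) → (x + y + α) % 2 = 0 → ConeIsolated n F x y →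
      F.Adj (x, y) (x, y + 1) ∧
      ∀ R, F.Adj (x, y) R → R ≠ (x, y + 1) → ∃ (o : ℤ × ℤ) (p : F.Walk R o), p.IsPath ∧
        (x, y) ∉ p.support ∧ ¬ IsGridVertex n o ∧ o.1 - x + o.2 ≤ y + 1 ∧ x - o.1 + o.2 ≤ y + 1 ∧
        (∃ v, F.Adj o v) ∧ ∀ w ∈ p.support, w.2 ≤ y := by
  induction m with
  | zero =>
    intro x y hy hv
    simp only [IsGridVertex] at hv
    omega
  | succ m ih =>
    intro x y hy hv hc hcone
    have descent : ∀ R, F.Adj (x, y) R → R ≠ (x, y + 1) → ∃ (o : ℤ × ℤ) (p : F.Walk R o),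
        p.IsPath ∧ (x, y) ∉ p.support ∧ ¬ IsGridVertex n o ∧ o.1 - x + o.2 ≤ y + 1 ∧
        x - o.1 + o.2 ≤ y + 1 ∧ (∃ v, F.Adj o v) ∧ ∀ w ∈ p.support, w.2 ≤ y := by
      rintro ⟨r₁, r₂⟩ hR hne
      have hb := (board_adj (hF hR)).2
      have hne' : ¬ (r₁ = x ∧ r₂ = y + 1) := by simpa using hne
      have hne2 : (x, y) ≠ (r₁, r₂) := hR.ne
      simp only at hb
      by_cases hg : IsGridVertex n (r₁, r₂)
      · have hg' := hg
        simp only [IsGridVertex] at hg' hv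
        by_cases hr : r₂ = 1
        · subst hr
          -- A neighbour of `(x, y)` in the bottom row has just the parity at which the external
          -- edge below is occupied.
          have ha := hbot r₁ (by omega) (by omega) (by omega)
          refine ⟨(r₁, 0), .cons ha .nil, by simp, ?_, by simp [IsGridVertex], ?_, ?_,
            ⟨_, ha.symm⟩, ?_⟩
          · simp only [Walk.support_cons, Walk.support_nil, List.mem_cons, List.not_mem_nil,
              or_false, not_or]
            refine ⟨hne2, fun h => ?_⟩
            have := congrArg Prod.snd h
            simp only at this
            omega
          · simp only; omega
          · simp only; omega
          · intro w hw
            simp only [Walk.support_cons, Walk.support_nil, List.mem_cons, List.not_mem_nil,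
              or_false] at hw
            rcases hw with rfl | rfl <;> simp only <;> omega
        -- The vertex below `R` has the parity of `(x, y)`, smaller height and a smaller cone. By
        -- induction its upper edge, the one to `R`, is occupied, so the path can continue downwards
        -- through it.
        · have hQ : IsGridVertex n (r₁, r₂ - 1) := by simp only [IsGridVertex]; omega
          obtain ⟨hup, hdesc⟩ := ih r₁ (r₂ - 1) (by omega) hQ (by omega) (by
            intro o o' h1 h2 h3 h4 h5 h6 h7 h8 h9
            exact hcone o o' h1 h2 h3 h4 (by omega) (by omega) (by omega) (by omega) h9)
          rw [sub_add_cancel] at hup hdesc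
          obtain ⟨R', hR', hne'⟩ : ∃ R', F.Adj (r₁, r₂ - 1) R' ∧ R' ≠ (r₁, r₂) := by
            obtain ⟨s, t, hst, hs⟩ := Set.ncard_eq_two.1 (h2 _ hQ)
            have hs1 : s ∈ F.neighborSet (r₁, r₂ - 1) := by rw [hs]; simp
            have hs2 : t ∈ F.neighborSet (r₁, r₂ - 1) := by rw [hs]; simp
            by_cases h : s = (r₁, r₂)
            · exact ⟨t, hs2, fun h' => hst (h.trans h'.symm)⟩
            · exact ⟨s, hs1, h⟩
          obtain ⟨o, p, hp, hQp, ho, ho1, ho2, hoc, hpy⟩ := hdesc R' hR' hne'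
          refine ⟨o, .cons hup.symm (.cons hR' p), ?_, ?_, ho, by omega, by omega, hoc, ?_⟩
          · rw [Walk.cons_isPath_iff, Walk.cons_isPath_iff]
            refine ⟨⟨hp, hQp⟩, fun h => ?_⟩
            rw [Walk.support_cons, List.mem_cons] at h
            rcases h with h | h
            · have := congrArg Prod.snd h
              simp only at this
              omega
            · have := hpy _ h
              simp only at this
              omega
          · simp only [Walk.support_cons, List.mem_cons, not_or]
            refine ⟨hne2, fun h => ?_, fun h => ?_⟩
            · have := congrArg Prod.snd h
              simp only at this
              omega
            · have := hpy _ h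
              simp only at this
              omega
          · intro w hw
            simp only [Walk.support_cons, List.mem_cons] at hw
            rcases hw with rfl | rfl | hw
            · simp only; omega
            · simp only; omega
            · have := hpy _ hw
              omega
      · refine ⟨(r₁, r₂), .nil, by simp, by simpa using hne2, hg, ?_, ?_, ⟨_, hR.symm⟩, ?_⟩
        · simp only; omega
        · simp only; omega
        · intro w hw
          simp only [Walk.support_nil, List.mem_cons, List.not_mem_nil, or_false] at hw
          subst hw
          simp only
          omega
    refine ⟨?_, descent⟩
    -- If the upper edge is free, both occupied edges at `(x, y)` start a descent. Isolation of the
    -- cone makes the two ends equal, against the uniqueness of the path to a leaf.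
    by_contra hup
    obtain ⟨s, t, hst, hs⟩ := Set.ncard_eq_two.1 (h2 _ hv)
    have hs1 : F.Adj (x, y) s := by
      have : s ∈ F.neighborSet (x, y) := by rw [hs]; simp
      exact this
    have hs2 : F.Adj (x, y) t := by
      have : t ∈ F.neighborSet (x, y) := by rw [hs]; simp
      exact this
    obtain ⟨o, p, hp, hPp, ho, ho1, ho2, hoc, -⟩ :=
      descent s hs1 (by rintro rfl; exact hup hs1)
    obtain ⟨o', p', hp', hPp', ho', ho1', ho2', hoc', -⟩ :=
      descent t hs2 (by rintro rfl; exact hup hs2)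
    have : o = o' := hcone o o' ho ho' hoc hoc' ho1 ho2 ho1' ho2'
      ((p.reachable.symm.trans hs1.symm.reachable).trans (hs2.reachable.trans p'.reachable))
    subst this
    have := (degLeTwo_of_two_edges hF h2).path_unique (isLeaf_of_le_board hF ho)
      (.cons hs1 p) (.cons hs2 p') (hp.cons hPp) (hp'.cons hPp')
    simp only [Walk.cons.injEq] at this
    exact hst this.1

/-! ### Bundles and centres on the boundary cycle -/

/-- The configuration `F` consists of three bundles of `r i` nested arches centred at `X i`,
in counterclockwise order. -/
structure IsBundled (n : ℕ) (r : Fin 3 → ℕ) (X : Fin 3 → ZMod (4 * n))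
    (F : SimpleGraph (ℤ × ℤ)) : Prop where
  pos : ∀ i, 0 < r i
  sum : r 0 + r 1 + r 2 = n
  next : ∀ i, X (i + 1) = X i + (2 * (r i + r (i + 1)) : ℕ)
  isFPL : IsFPL n F
  unoccupied : ¬ Occupied n F (X 0)
  arches : ∀ i, HasNestedArches n F (X i) (r i)

/-- The clockwise case becomes counterclockwise when the centres are listed as `C`, `B`, `A`. One
choice of `r` and `X` serves all configurations of the type. -/
theorem AreCentres.exists_isBundled {n a b c : ℕ} {A B C : ZMod (4 * n)} (ha : 0 < a) (hb : 0 < b)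
    (hc : 0 < c) (hn : a + b + c = n) (h : AreCentres n a b c A B C) :
    ∃ r X, ∀ F, IsOfType n a b c A B C F → IsBundled n r X F := by
  rcases h with ⟨h1, h2, h3⟩ | ⟨h1, h2, h3⟩
  · refine ⟨![a, b, c], ![A, B, C], fun F hF => ⟨?_, hn, ?_, hF.isFPL, hF.unoccupied_A, ?_⟩⟩
    · simp [Fin.forall_fin_succ, *]
    · simp only [Fin.forall_fin_succ]
      exact ⟨h1, h2, h3, by simp⟩
    · simp only [Fin.forall_fin_succ]
      exact ⟨hF.arches_A, hF.arches_B, hF.arches_C, by simp⟩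
  · refine ⟨![c, b, a], ![C, B, A], fun F hF => ⟨?_, ?_, ?_, hF.isFPL, hF.unoccupied_C, ?_⟩⟩
    · simp [Fin.forall_fin_succ, *]
    · rw [← hn]
      change c + b + a = _
      omega
    · simp only [Fin.forall_fin_succ]
      refine ⟨?_, ?_, ?_, by simp⟩
      · change B = C + (2 * (c + b) : ℕ)
        rw [h2, add_comm c b]; ring
      · change A = B + (2 * (b + a) : ℕ)
        rw [h1, add_comm b a]; ring
      · change C = A + (2 * (a + c) : ℕ)
        rw [h3, add_comm a c]; ring
    · simp only [Fin.forall_fin_succ]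
      exact ⟨hF.arches_C, hF.arches_B, hF.arches_A, by simp⟩

theorem outer_injective {n : ℕ} (hn : 0 < n) : Function.Injective (outer n) := by
  have : NeZero (4 * n) := ⟨by omega⟩
  intro k l h
  have hk := ZMod.val_lt k
  have hl := ZMod.val_lt l
  apply ZMod.val_injective
  unfold outer at h
  split_ifs at h <;> simp only [Prod.mk.injEq] at h <;> omega

theorem exists_eq_outer {n : ℕ} {o v : ℤ × ℤ} (ho : ¬ IsGridVertex n o) (h : (board n).Adj o v) :
    ∃ k : ℕ, k < 4 * n ∧ o = outer n k := by
  obtain ⟨o₁, o₂⟩ := o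
  have hb := board_adj h
  simp only [IsGridVertex] at ho hb
  have key : ∀ k : ℕ, k < 4 * n → ((k : ZMod (4 * n)).val) = k := fun k hk => ZMod.val_cast_of_lt hk
  by_cases h1 : o₂ = 0
  · refine ⟨(o₁ - 1).toNat, by omega, ?_⟩
    unfold outer
    rw [key _ (by omega), if_pos (by omega)]
    ext <;> simp only <;> omega
  by_cases h2 : o₁ = n + 1
  · refine ⟨(n + o₂ - 1).toNat, by omega, ?_⟩
    unfold outer
    rw [key _ (by omega), if_neg (by omega), if_pos (by omega)]
    ext <;> simp only <;> omega
  by_cases h3 : o₂ = n + 1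
  · refine ⟨(3 * n - o₁).toNat, by omega, ?_⟩
    unfold outer
    rw [key _ (by omega), if_neg (by omega), if_neg (by omega), if_pos (by omega)]
    ext <;> simp only <;> omega
  · refine ⟨(4 * n - o₂).toNat, by omega, ?_⟩
    unfold outer
    rw [key _ (by omega), if_neg (by omega), if_neg (by omega), if_neg (by omega)]
    ext <;> simp only <;> omega

section
variable {n : ℕ} {r : Fin 3 → ℕ} {X : Fin 3 → ZMod (4 * n)} {F : SimpleGraph (ℤ × ℤ)}

theorem IsBundled.occupied_iff (h : IsBundled n r X F) {α : ℤ} (hα : (α : ZMod (4 * n)) = X 0)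
    (s : ℤ) : Occupied n F s ↔ (s + α) % 2 = 1 := by
  have key : ∀ m : ℤ, Occupied n F (X 0 + m) ↔ m % 2 = 1 := by
    intro m
    induction m using Int.induction_on with
    | zero => simpa using h.unoccupied
    | succ i ih =>
      have := h.isFPL.alternating (X 0 + ((i : ℤ) : ZMod (4 * n)))
      rw [add_assoc] at this
      rw [Int.cast_add, Int.cast_one, this, ih]
      omega
    | pred i ih =>
      have := h.isFPL.alternating (X 0 + ((-(i : ℤ) - 1 : ℤ) : ZMod (4 * n)))
      rw [add_assoc, Int.cast_sub (-(i : ℤ)), Int.cast_one, sub_add_cancel, ih] at this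
      rw [Int.cast_sub, Int.cast_one]
      have h2 := not_congr this
      rw [not_not] at h2
      rw [← h2]
      omega
  have := key (s - α)
  rw [← hα, Int.cast_sub, add_sub_cancel] at this
  rw [this]
  omega

/-- Since `r 0 + r 1 + r 2 = n`, the half bundles met from `X 0` onwards, of sizes `r 0, r 1, r 1, r
2, r 2, r 0`, exhaust the `2 n` occupied external edges. The six cases below are these half bundles,
located by the distance `m` from `X 0`. -/
theorem IsBundled.exists_partner (h : IsBundled n r X F) {k : ZMod (4 * n)}
    (hk : Occupied n F k) : ∃ i j, j < r i ∧
      (k = X i + (2 * j + 1 : ℕ) ∨ k = X i - (2 * j + 1 : ℕ)) := by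
  have hn := h.sum
  have p0 := h.pos 0
  have : NeZero (4 * n) := ⟨by omega⟩
  set m := (k - X 0).val with hm
  have hm4 : m < 4 * n := ZMod.val_lt _
  have hkm : k = X 0 + (m : ZMod (4 * n)) := by rw [hm, ZMod.natCast_zmod_val]; ring
  have hodd : m % 2 = 1 := by
    have := (h.occupied_iff (α := (X 0).val) (by simp) (m + (X 0).val : ℤ)).1 (by
      simpa [add_comm, ← hkm] using hk)
    omega
  have h1 : X 1 = X 0 + (2 * (r 0 + r 1) : ℕ) := h.next 0
  have h2 : X 2 = X 1 + (2 * (r 1 + r 2) : ℕ) := h.next 1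
  have h4 : ((4 * n : ℕ) : ZMod (4 * n)) = 0 := ZMod.natCast_self _
  have cast : ∀ u v : ℕ, u = v → (u : ZMod (4 * n)) = v := fun u v h => by rw [h]
  by_cases c1 : m < 2 * r 0
  · refine ⟨0, (m - 1) / 2, by omega, Or.inl ?_⟩
    rw [hkm, show 2 * ((m - 1) / 2) + 1 = m by omega]
  by_cases c2 : m < 2 * r 0 + 2 * r 1
  · refine ⟨1, (2 * (r 0 + r 1) - m - 1) / 2, by omega, Or.inr ?_⟩
    have := cast (m + (2 * ((2 * (r 0 + r 1) - m - 1) / 2) + 1)) (2 * (r 0 + r 1)) (by omega)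
    rw [hkm, h1, ← this, Nat.cast_add m]
    ring
  by_cases c3 : m < 2 * r 0 + 4 * r 1
  · refine ⟨1, (m - 2 * (r 0 + r 1) - 1) / 2, by omega, Or.inl ?_⟩
    have := cast (2 * (r 0 + r 1) + (2 * ((m - 2 * (r 0 + r 1) - 1) / 2) + 1)) m (by omega)
    rw [hkm, h1, ← this, Nat.cast_add (2 * (r 0 + r 1))]
    ring
  by_cases c4 : m < 2 * r 0 + 4 * r 1 + 2 * r 2
  · refine ⟨2, (2 * (r 0 + r 1) + 2 * (r 1 + r 2) - m - 1) / 2, by omega, Or.inr ?_⟩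
    have := cast (m + (2 * ((2 * (r 0 + r 1) + 2 * (r 1 + r 2) - m - 1) / 2) + 1))
      (2 * (r 0 + r 1) + 2 * (r 1 + r 2)) (by omega)
    rw [hkm, h2, h1, add_assoc, ← Nat.cast_add, ← this, Nat.cast_add m]
    ring
  by_cases c5 : m < 2 * r 0 + 4 * r 1 + 4 * r 2
  · refine ⟨2, (m - (2 * (r 0 + r 1) + 2 * (r 1 + r 2)) - 1) / 2, by omega, Or.inl ?_⟩
    have := cast (2 * (r 0 + r 1) + 2 * (r 1 + r 2) +
      (2 * ((m - (2 * (r 0 + r 1) + 2 * (r 1 + r 2)) - 1) / 2) + 1)) m (by omega)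
    rw [hkm, h2, h1, ← this, Nat.cast_add (2 * (r 0 + r 1) + 2 * (r 1 + r 2)),
      Nat.cast_add (2 * (r 0 + r 1))]
    ring
  · refine ⟨0, (4 * n - m - 1) / 2, by omega, Or.inr ?_⟩
    have := cast (m + (2 * ((4 * n - m - 1) / 2) + 1)) (4 * n) (by omega)
    rw [h4, Nat.cast_add m] at this
    rw [hkm]
    linear_combination this

/-- Outer end points are leaves, and a path has only two ends. -/
theorem IsBundled.eq_partner (h : IsBundled n r X F) {k l m : ZMod (4 * n)} (hk : Linked n F k l)
    (hm : Linked n F k m) : l = m := by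
  have hn := h.sum
  have p0 := h.pos 0
  have hinj := outer_injective (n := n) (by omega)
  have leaf : ∀ k, IsLeaf F (outer n k) := fun k =>
    isLeaf_of_le_board h.isFPL.le_board (not_isGridVertex_outer n k)
  exact hinj <| (degLeTwo_of_two_edges h.isFPL.le_board h.isFPL.two_edges).leaf_unique
    (leaf k) (leaf l) (leaf m) (fun e => hk.2.2.1 (hinj e)) (fun e => hm.2.2.1 (hinj e))
    hk.2.2.2 hm.2.2.2

theorem Linked.symm {k l : ZMod (4 * n)} (h : Linked n F k l) : Linked n F l k :=
  ⟨h.2.1, h.1, h.2.2.1.symm, h.2.2.2.symm⟩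

/-- Two linked external edges have a centre on either side. -/
theorem IsBundled.exists_centre_between (h : IsBundled n r X F) {k l : ZMod (4 * n)}
    (hkl : Linked n F k l) {s t : ℤ} (hs : (s : ZMod (4 * n)) = k) (ht : (t : ZMod (4 * n)) = l)
    (hst : s < t) (hst' : t - s ≤ 2 * n) :
    ∃ (i : Fin 3) (u : ℤ), s < u ∧ u < t ∧ (u : ZMod (4 * n)) = X i := by
  obtain ⟨i, j, hj, hk⟩ := h.exists_partner hkl.1
  have harch := h.arches i j hj
  have hsum : ∀ i : Fin 3, r i + r (i + 1) + r (i + 2) = n := by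
    have := h.sum
    intro i
    fin_cases i
    · exact this
    · change r 1 + r 2 + r 0 = n
      omega
    · change r 2 + r 0 + r 1 = n
      omega
  have hi := hsum i
  have p1 := h.pos (i + 1)
  have p2 := h.pos (i + 2)
  rcases hk with hk | hk
  · have hl : l = X i - (2 * j + 1 : ℕ) := h.eq_partner (hk ▸ hkl) harch
    -- Here `s` comes after its centre, so the way from `s` to `t` runs outside the arch and has
    -- length `4 n - 2 (2 j + 1)`; it passes the next centre. In the other case it runs inside the
    -- arch, over the centre `X i` itself.
    have hd : ((t - s + 2 * (2 * j + 1) - 4 * n : ℤ) : ZMod (4 * n)) = 0 := by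
      have h4 : ((4 * n : ℕ) : ZMod (4 * n)) = 0 := ZMod.natCast_self _
      push_cast at hk hl h4 ⊢
      rw [hs, ht, hk, hl]
      linear_combination -h4
    rw [ZMod.intCast_zmod_eq_zero_iff_dvd] at hd
    have h0 := Int.eq_zero_of_abs_lt_dvd hd (by push_cast; rw [abs_lt]; constructor <;> omega)
    refine ⟨i + 1, s - (2 * j + 1) + 2 * (r i + r (i + 1)), by omega, by omega, ?_⟩
    rw [h.next]
    push_cast at hk ⊢
    rw [hs, hk]
    ring
  · have hl : l = X i + (2 * j + 1 : ℕ) := h.eq_partner (hk ▸ hkl) harch.symm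
    have hd : ((t - s - 2 * (2 * j + 1) : ℤ) : ZMod (4 * n)) = 0 := by
      push_cast at hk hl ⊢
      rw [hs, ht, hk, hl]
      ring
    rw [ZMod.intCast_zmod_eq_zero_iff_dvd] at hd
    have h0 := Int.eq_zero_of_abs_lt_dvd hd (by push_cast; rw [abs_lt]; constructor <;> omega)
    refine ⟨i, s + (2 * j + 1), by omega, by omega, ?_⟩
    push_cast at hk ⊢
    rw [hs, hk]
    ring

/-- The arc of the boundary in the cone below the vertex `(x, y)`. -/
theorem IsBundled.index_of_mem_cone (h : IsBundled n r X F) {α : ℤ}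
    (hα : (α : ZMod (4 * n)) = X 0) {x y : ℤ} (hv : IsGridVertex n (x, y))
    (hc : (x + y + α) % 2 = 0) {o : ℤ × ℤ} (ho : ¬ IsGridVertex n o) (hocc : ∃ v, F.Adj o v)
    (h₁ : o.1 - x + o.2 ≤ y + 1) (h₂ : x - o.1 + o.2 ≤ y + 1) :
    ∃ s : ℤ, x - y ≤ s ∧ s ≤ x + y ∧ o = outer n (s - 1 : ℤ) := by
  obtain ⟨v, hov⟩ := hocc
  obtain ⟨k, hk, rfl⟩ := exists_eq_outer ho (h.isFPL.le_board hov)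
  have hval : ((k : ZMod (4 * n)).val) = k := ZMod.val_cast_of_lt hk
  have hpar := (h.occupied_iff hα k).1 ⟨v, by simpa using hov⟩
  simp only [IsGridVertex] at hv
  unfold outer at h₁ h₂
  rw [hval] at h₁ h₂
  -- Edges on the left side get positions `s ≤ 0`, a full turn back, so that a cone reaching round
  -- the lower left corner still meets an interval of positions. The parity in `hpar` sharpens the
  -- bound `y + 1` to `y`.
  by_cases hk4 : k < 3 * n
  · refine ⟨k + 1, ?_, ?_, by simp⟩
    all_goals split_ifs at h₁ h₂ <;> simp only at h₁ h₂ <;> omega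
  · refine ⟨k + 1 - 4 * n, ?_, ?_, ?_⟩
    · split_ifs at h₁ h₂ <;> simp only at h₁ h₂ <;> omega
    · split_ifs at h₁ h₂ <;> simp only at h₁ h₂ <;> omega
    · have h4 : ((4 * n : ℕ) : ZMod (4 * n)) = 0 := ZMod.natCast_self _
      congr 1
      push_cast at h4 ⊢
      linear_combination h4

/-- Every other vertical edge is occupied above the arcs of the bottom side without centre. -/
theorem IsBundled.adj_up (h : IsBundled n r X F) {α : ℤ}
    (hα : (α : ZMod (4 * n)) = X 0) {x y : ℤ} (hv : IsGridVertex n (x, y))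
    (hc : (x + y + α) % 2 = 0)
    (hfree : ∀ i (t : ℤ), x - y < t → t < x + y → (t : ZMod (4 * n)) ≠ X i + 1) :
    F.Adj (x, y) (x, y + 1) := by
  have hn := h.sum
  have p0 := h.pos 0
  have hv' := hv
  simp only [IsGridVertex] at hv'
  refine (ConeIsolated.adj_up_and_descent (α := α) h.isFPL.le_board h.isFPL.two_edges ?_ y.toNat
    x y (by omega) hv hc ?_).1
  · intro z hz1 hzn hz
    have ho : outer n (((z - 1).toNat : ℕ) : ZMod (4 * n)) = (z, 0) := by
      unfold outer
      rw [ZMod.val_cast_of_lt (by omega), if_pos (by omega)]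
      ext <;> simp only
      omega
    obtain ⟨v, hzv⟩ := (h.occupied_iff hα ((z - 1).toNat : ℤ)).2 (by omega)
    rw [Int.cast_natCast, ho] at hzv
    have hb := board_adj (h.isFPL.le_board hzv)
    simp only [IsGridVertex] at hb
    have : v = (z, 1) := by ext <;> simp only <;> omega
    rw [this] at hzv
    exact hzv.symm
  · intro o o' ho ho' hocc hocc' h1 h2 h3 h4 hr
    obtain ⟨s, hs1, hs2, rfl⟩ := h.index_of_mem_cone hα hv hc ho hocc h1 h2
    obtain ⟨t, ht1, ht2, rfl⟩ := h.index_of_mem_cone hα hv hc ho' hocc' h3 h4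
    by_contra hne
    have hl : Linked n F ((s - 1 : ℤ) : ZMod (4 * n)) ((t - 1 : ℤ) : ZMod (4 * n)) :=
      ⟨hocc, hocc', fun e => hne (by rw [e]), hr⟩
    -- Positions count from one, so as to be abscissas on the bottom side; edge numbers count from
    -- zero.
    have hfree' : ∀ i (u : ℤ), x - y - 1 < u → u < x + y - 1 → (u : ZMod (4 * n)) ≠ X i := by
      intro i u hu1 hu2 hu
      refine hfree i (u + 1) (by omega) (by omega) ?_
      rw [← hu]
      push_cast
      ring
    rcases lt_trichotomy s t with hst | rfl | hst
    · obtain ⟨i, u, hu1, hu2, hu⟩ := h.exists_centre_between hl rfl rfl (by omega) (by omega)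
      exact hfree' i u (by omega) (by omega) hu
    · exact hne rfl
    · obtain ⟨i, u, hu1, hu2, hu⟩ := h.exists_centre_between hl.symm rfl rfl (by omega) (by omega)
      exact hfree' i u (by omega) (by omega) hu

end

/-! ### Rotation of the forced edges to the four sides -/

/-- The rotation of the square by a quarter turn, counterclockwise. -/
def rot (n : ℕ) : ℤ × ℤ ≃ ℤ × ℤ where
  toFun v := (n + 1 - v.2, v.1)
  invFun v := (v.2, n + 1 - v.1)
  left_inv v := by ext <;> simp
  right_inv v := by ext <;> simp

theorem isGridVertex_rot {n : ℕ} {v : ℤ × ℤ} : IsGridVertex n (rot n v) ↔ IsGridVertex n v := by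
  simp only [IsGridVertex, rot, Equiv.coe_fn_mk]
  omega

theorem board_adj_rot {n : ℕ} {u v : ℤ × ℤ} :
    (board n).Adj (rot n u) (rot n v) ↔ (board n).Adj u v := by
  change _ ∧ (IsGridVertex n (rot n u) ∨ IsGridVertex n (rot n v)) ↔ _
  rw [isGridVertex_rot, isGridVertex_rot]
  refine and_congr_left fun _ => ?_
  simp only [rot, Equiv.coe_fn_mk]
  rw [sub_sub_sub_cancel_left, abs_sub_comm v.2, add_comm]

theorem outer_add {n : ℕ} (hn : 0 < n) (k : ZMod (4 * n)) : outer n (k + n) = rot n (outer n k) := by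
  have : NeZero (4 * n) := ⟨by omega⟩
  have hk := ZMod.val_lt k
  have hnv : ((n : ZMod (4 * n))).val = n := ZMod.val_cast_of_lt (by omega)
  have hv : k.val < 3 * n ∧ (k + n : ZMod (4 * n)).val = k.val + n ∨
      3 * n ≤ k.val ∧ (k + n : ZMod (4 * n)).val = k.val + n - 4 * n := by
    rw [ZMod.val_add, hnv]
    by_cases h : k.val + n < 4 * n
    · exact Or.inl ⟨by omega, Nat.mod_eq_of_lt h⟩
    · right
      refine ⟨by omega, ?_⟩
      rw [Nat.mod_eq_sub_mod (by omega), Nat.mod_eq_of_lt (by omega)]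
  unfold outer rot
  simp only [Equiv.coe_fn_mk]
  split_ifs <;> ext <;> simp only <;> omega

section
variable {n : ℕ} {r : Fin 3 → ℕ} {X : Fin 3 → ZMod (4 * n)} {F : SimpleGraph (ℤ × ℤ)}

theorem occupied_comap_rot (hn : 0 < n) {k : ZMod (4 * n)} :
    Occupied n (F.comap (rot n)) k ↔ Occupied n F (k + n) := by
  simp only [Occupied, comap_adj, outer_add hn]
  exact (rot n).surjective.exists.symm

theorem linked_comap_rot (hn : 0 < n) {k l : ZMod (4 * n)} :
    Linked n (F.comap (rot n)) k l ↔ Linked n F (k + n) (l + n) := by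
  simp only [Linked, occupied_comap_rot hn, outer_add hn, ne_eq, add_left_inj]
  rw [← (Iso.comap (rot n) F).reachable_iff]
  rfl

/-- A quarter turn shifts the numbers of the external edges by `n`. Applied repeatedly, it carries
`adj_up` to the other three directions, with the parity condition alternating. -/
theorem IsBundled.rotate (h : IsBundled n r X F) :
    IsBundled n r (fun i => X i - n) (F.comap (rot n)) := by
  have hn := h.sum
  have p0 := h.pos 0
  have hn' : 0 < n := by omega
  refine ⟨h.pos, h.sum, fun i => ?_, ⟨?_, ?_, ?_⟩, ?_, ?_⟩
  · rw [h.next]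
    ring
  · intro u v huv
    exact board_adj_rot.1 (h.isFPL.le_board huv)
  · intro v hv
    rw [← h.isFPL.two_edges (rot n v) (isGridVertex_rot.2 hv)]
    have : (F.comap (rot n)).neighborSet v = rot n ⁻¹' F.neighborSet (rot n v) := rfl
    rw [this, Set.ncard_preimage_of_injective_subset_range (rot n).injective (by simp)]
  · intro k
    rw [occupied_comap_rot hn', occupied_comap_rot hn', add_right_comm]
    exact h.isFPL.alternating _
  · rw [occupied_comap_rot hn', sub_add_cancel]
    exact h.unoccupied
  · intro i j hj
    rw [linked_comap_rot hn', add_right_comm, sub_add_cancel, sub_right_comm, sub_add_cancel]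
    exact h.arches i j hj

theorem IsBundled.adj_left (h : IsBundled n r X F) {α : ℤ}
    (hα : (α : ZMod (4 * n)) = X 0) {x y : ℤ} (hv : IsGridVertex n (x, y))
    (hc : (x + y + α) % 2 = 1)
    (hfree : ∀ i (t : ℤ), x + y - 1 < t → t < 2 * n + 1 + y - x →
      (t : ZMod (4 * n)) ≠ X i + 1) :
    F.Adj (x, y) (x - 1, y) := by
  have := h.rotate.adj_up (α := α - n) (x := y) (y := n + 1 - x) (by push_cast; rw [hα])
    (isGridVertex_rot.1 (by simpa [rot] using hv)) (by omega) (fun i t h1 h2 h3 => by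
      refine hfree i (t + n) (by omega) (by omega) ?_
      push_cast
      rw [h3]
      ring)
  simpa [rot, sub_sub_eq_add_sub, ← sub_sub] using this

theorem IsBundled.adj_down (h : IsBundled n r X F) {α : ℤ}
    (hα : (α : ZMod (4 * n)) = X 0) {x y : ℤ} (hv : IsGridVertex n (x, y))
    (hc : (x + y + α) % 2 = 0)
    (hfree : ∀ i (t : ℤ), 2 * n - x + y < t → t < 4 * n + 2 - x - y →
      (t : ZMod (4 * n)) ≠ X i + 1) :
    F.Adj (x, y) (x, y - 1) := by
  have := h.rotate.adj_left (α := α - n) (x := y) (y := n + 1 - x) (by push_cast; rw [hα])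
    (isGridVertex_rot.1 (by simpa [rot] using hv)) (by omega) (fun i t h1 h2 h3 => by
      refine hfree i (t + n) (by omega) (by omega) ?_
      push_cast
      rw [h3]
      ring)
  simpa [rot] using this

theorem IsBundled.adj_right (h : IsBundled n r X F) {α : ℤ}
    (hα : (α : ZMod (4 * n)) = X 0) {x y : ℤ} (hv : IsGridVertex n (x, y))
    (hc : (x + y + α) % 2 = 1)
    (hfree : ∀ i (t : ℤ), 4 * n + 1 - x - y < t → t < 4 * n + 1 + x - y →
      (t : ZMod (4 * n)) ≠ X i + 1) :
    F.Adj (x, y) (x + 1, y) := by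
  have := h.rotate.adj_down (α := α - n) (x := y) (y := n + 1 - x) (by push_cast; rw [hα])
    (isGridVertex_rot.1 (by simpa [rot] using hv)) (by omega) (fun i t h1 h2 h3 => by
      refine hfree i (t + n) (by omega) (by omega) ?_
      push_cast
      rw [h3]
      ring)
  simp only [rot, comap_adj, Equiv.coe_fn_mk, sub_sub_cancel] at this
  convert this using 2
  ring

end

/-! ### Forced edges around a unit square -/

/-- The external edge in position `t` of the boundary lies to the upper right of the unit square
with lower left corner `(x, y)`. -/
def UpperRight (n : ℕ) (x y t : ℤ) : Prop :=
  x + y + 1 < t ∧ t < 4 * n + 1 - x - y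

/-- The external edge in position `t` of the boundary lies to the upper left of the unit square
with lower left corner `(x, y)`. -/
def UpperLeft (n : ℕ) (x y t : ℤ) : Prop :=
  (2 * n + 1 + y - x < t ∧ t < 4 * n + 1 + x - y) ∨ t < 1 + x - y

section
variable {n : ℕ} {r : Fin 3 → ℕ} {X : Fin 3 → ZMod (4 * n)} {F : SimpleGraph (ℤ × ℤ)}

theorem eq_val_add_one {k : ZMod (4 * n)} {t : ℤ} (hn : 0 < n) (h : (t : ZMod (4 * n)) = k + 1)
    (h₁ : -4 * n < t) (h₂ : t ≤ 8 * n) :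
    t = k.val + 1 ∨ t = k.val + 1 - 4 * n ∨ t = k.val + 1 + 4 * n := by
  have : NeZero (4 * n) := ⟨by omega⟩
  have hk := ZMod.val_lt k
  have h0 : ((t - (k.val + 1) : ℤ) : ZMod (4 * n)) = 0 := by
    push_cast
    rw [h, ZMod.natCast_zmod_val]
    ring
  rw [ZMod.intCast_zmod_eq_zero_iff_dvd] at h0
  obtain ⟨c, hc⟩ := h0
  push_cast at hc
  have c1 : c < 2 := by
    by_contra hcc
    nlinarith
  have c2 : -2 < c := by
    by_contra hcc
    nlinarith
  have : c = -1 ∨ c = 0 ∨ c = 1 := by omega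
  rcases this with rfl | rfl | rfl <;> omega

/-- The edges of a unit square forced by the absence of centres in one of four directions. -/
theorem IsBundled.forced_of_odd (h : IsBundled n r X F) {x y : ℤ} (hx : 1 ≤ x) (hxn : x < n)
    (hy : 1 ≤ y) (hyn : y < n) (hc : (x + y + (X 0).val) % 2 = 1) :
    ((∀ i, UpperRight n x y ((X i).val + 1) → UpperLeft n x y ((X i).val + 1)) →
      F.Adj (x, y + 1) (x + 1, y + 1)) ∧
    ((∀ i, UpperLeft n x y ((X i).val + 1) → UpperRight n x y ((X i).val + 1)) →
      F.Adj (x, y) (x + 1, y)) ∧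
    ((∀ i, UpperLeft n x y ((X i).val + 1) → ¬ UpperRight n x y ((X i).val + 1)) →
      F.Adj (x, y) (x, y + 1)) ∧
    ((∀ i, UpperLeft n x y ((X i).val + 1) ∨ UpperRight n x y ((X i).val + 1)) →
      F.Adj (x + 1, y) (x + 1, y + 1)) := by
  have hn : 0 < n := by omega
  have : NeZero (4 * n) := ⟨by omega⟩
  have hα : (((X 0).val : ℤ) : ZMod (4 * n)) = X 0 := by simp
  -- The hypotheses keep centres out of the right, left, top and bottom arc, in this order. The cone
  -- opening to the right forces the upper edge, the left one the lower edge, the top one the left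
  -- edge, the bottom one the right edge.
  simp only [UpperLeft, UpperRight]
  refine ⟨fun hf => ?_, fun hf => ?_, fun hf => ?_, fun hf => ?_⟩
  · have := h.adj_left hα (x := x + 1) (y := y + 1) (by simp only [IsGridVertex]; omega) (by omega)
      (fun i t h1 h2 h3 => by
        have := hf i
        have := ZMod.val_lt (X i)
        have := eq_val_add_one hn h3 (by omega) (by omega)
        omega)
    simpa using this.symm
  · have := h.adj_right hα (x := x) (y := y) (by simp only [IsGridVertex]; omega) (by omega)
      (fun i t h1 h2 h3 => by
        have := hf i
        have := ZMod.val_lt (X i)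
        have := eq_val_add_one hn h3 (by omega) (by omega)
        omega)
    exact this
  · have := h.adj_down hα (x := x) (y := y + 1) (by simp only [IsGridVertex]; omega) (by omega)
      (fun i t h1 h2 h3 => by
        have := hf i
        have := ZMod.val_lt (X i)
        have := eq_val_add_one hn h3 (by omega) (by omega)
        omega)
    simpa using this.symm
  · have := h.adj_up hα (x := x + 1) (y := y) (by simp only [IsGridVertex]; omega) (by omega)
      (fun i t h1 h2 h3 => by
        have := hf i
        have := ZMod.val_lt (X i)
        have := eq_val_add_one hn h3 (by omega) (by omega)
        omega)
    exact this

/-- The edges of a unit square forced by the absence of centres in one of four directions. -/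
theorem IsBundled.forced_of_even (h : IsBundled n r X F) {x y : ℤ} (hx : 1 ≤ x) (hxn : x < n)
    (hy : 1 ≤ y) (hyn : y < n) (hc : (x + y + (X 0).val) % 2 = 0) :
    ((∀ i, UpperRight n x y ((X i).val + 2) → UpperLeft n x y ((X i).val + 2)) →
      F.Adj (x, y) (x + 1, y)) ∧
    ((∀ i, UpperLeft n x y ((X i).val + 2) → UpperRight n x y ((X i).val + 2)) →
      F.Adj (x, y + 1) (x + 1, y + 1)) ∧
    ((∀ i, UpperLeft n x y ((X i).val + 2) → ¬ UpperRight n x y ((X i).val + 2)) →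
      F.Adj (x + 1, y) (x + 1, y + 1)) ∧
    ((∀ i, UpperLeft n x y ((X i).val + 2) ∨ UpperRight n x y ((X i).val + 2)) →
      F.Adj (x, y) (x, y + 1)) := by
  have hn : 0 < n := by omega
  have : NeZero (4 * n) := ⟨by omega⟩
  have hα : (((X 0).val : ℤ) : ZMod (4 * n)) = X 0 := by simp
  -- For the other parity each cone has its apex at another corner of the square, which moves its
  -- arc by one position; with `+ 2` for `+ 1` the bounds are those of the odd case.
  simp only [UpperLeft, UpperRight]
  refine ⟨fun hf => ?_, fun hf => ?_, fun hf => ?_, fun hf => ?_⟩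
  · have := h.adj_left hα (x := x + 1) (y := y) (by simp only [IsGridVertex]; omega) (by omega)
      (fun i t h1 h2 h3 => by
        have := hf i
        have := ZMod.val_lt (X i)
        have := eq_val_add_one hn h3 (by omega) (by omega)
        omega)
    simpa using this.symm
  · have := h.adj_right hα (x := x) (y := y + 1) (by simp only [IsGridVertex]; omega) (by omega)
      (fun i t h1 h2 h3 => by
        have := hf i
        have := ZMod.val_lt (X i)
        have := eq_val_add_one hn h3 (by omega) (by omega)
        omega)
    exact this
  · have := h.adj_down hα (x := x + 1) (y := y + 1) (by simp only [IsGridVertex]; omega) (by omega)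
      (fun i t h1 h2 h3 => by
        have := hf i
        have := ZMod.val_lt (X i)
        have := eq_val_add_one hn h3 (by omega) (by omega)
        omega)
    simpa using this.symm
  · have := h.adj_up hα (x := x) (y := y) (by simp only [IsGridVertex]; omega) (by omega)
      (fun i t h1 h2 h3 => by
        have := hf i
        have := ZMod.val_lt (X i)
        have := eq_val_add_one hn h3 (by omega) (by omega)
        omega)
    exact this

end

/-! ### Height functions -/

/-- `h` is a height function of `F` on the unit squares, given by their lower left corners: it
changes by one across every edge, the sign being given by the parity and the occupation of the
edge. -/
structure IsHeight (n : ℕ) (α : ℤ) (F : SimpleGraph (ℤ × ℤ)) (h : ℤ → ℤ → ℤ) : Prop where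
  vert : ∀ x y : ℤ, 1 ≤ x → x ≤ n → 0 ≤ y → y ≤ n →
    ((F.Adj (x, y) (x, y + 1) ↔ (x + y + α) % 2 = 0) ∧ h x y = h (x - 1) y + 1) ∨
    (¬ (F.Adj (x, y) (x, y + 1) ↔ (x + y + α) % 2 = 0) ∧ h x y = h (x - 1) y - 1)
  horiz : ∀ x y : ℤ, 0 ≤ x → x ≤ n → 1 ≤ y → y ≤ n →
    ((F.Adj (x, y) (x + 1, y) ↔ (x + y + α) % 2 = 0) ∧ h x y = h x (y - 1) - 1) ∨
    (¬ (F.Adj (x, y) (x + 1, y) ↔ (x + y + α) % 2 = 0) ∧ h x y = h x (y - 1) + 1)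
  parity : ∀ x y : ℤ, 0 ≤ x → x ≤ n → 0 ≤ y → y ≤ n → (h x y + x + y) % 2 = 0

open Classical in
/-- The height difference across a vertical edge. -/
noncomputable def vertStep (α : ℤ) (F : SimpleGraph (ℤ × ℤ)) (x y : ℤ) : ℤ :=
  if F.Adj (x, y) (x, y + 1) ↔ (x + y + α) % 2 = 0 then 1 else -1

open Classical in
/-- The height difference across a horizontal edge. -/
noncomputable def horizStep (α : ℤ) (F : SimpleGraph (ℤ × ℤ)) (x y : ℤ) : ℤ :=
  if F.Adj (x, y) (x + 1, y) ↔ (x + y + α) % 2 = 0 then 1 else -1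

theorem vertStep_spec (α : ℤ) (F : SimpleGraph (ℤ × ℤ)) (x y : ℤ) :
    vertStep α F x y = 1 ∧ (F.Adj (x, y) (x, y + 1) ↔ (x + y + α) % 2 = 0) ∨
      vertStep α F x y = -1 ∧ ¬ (F.Adj (x, y) (x, y + 1) ↔ (x + y + α) % 2 = 0) := by
  unfold vertStep
  split_ifs with h
  · exact Or.inl ⟨rfl, h⟩
  · exact Or.inr ⟨rfl, h⟩

theorem horizStep_spec (α : ℤ) (F : SimpleGraph (ℤ × ℤ)) (x y : ℤ) :
    horizStep α F x y = 1 ∧ (F.Adj (x, y) (x + 1, y) ↔ (x + y + α) % 2 = 0) ∨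
      horizStep α F x y = -1 ∧ ¬ (F.Adj (x, y) (x + 1, y) ↔ (x + y + α) % 2 = 0) := by
  unfold horizStep
  split_ifs with h
  · exact Or.inl ⟨rfl, h⟩
  · exact Or.inr ⟨rfl, h⟩

/-- The parity used for the lower and the left edge is opposite to that of `(x, y)`, so the equation
says that the four occupation numbers at the vertex add up to two. It closes the height differences
around a vertex. -/
theorem step_relation {n : ℕ} {F : SimpleGraph (ℤ × ℤ)} (hF : F ≤ board n) (α : ℤ) {x y : ℤ}
    (h2 : (F.neighborSet (x, y)).ncard = 2) :
    vertStep α F x y + horizStep α F x y = vertStep α F x (y - 1) + horizStep α F (x - 1) y := by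
  obtain ⟨s, t, hst, hs⟩ := Set.ncard_eq_two.1 h2
  clear h2
  have key : ∀ w : ℤ × ℤ, F.Adj (x, y) w ↔ (w.1 = s.1 ∧ w.2 = s.2) ∨ (w.1 = t.1 ∧ w.2 = t.2) := by
    intro w
    rw [← mem_neighborSet, hs, Set.mem_insert_iff, Set.mem_singleton_iff, Prod.ext_iff,
      Prod.ext_iff]
  have hs' := (board_adj (hF ((key s).2 (by simp)))).2
  have ht' := (board_adj (hF ((key t).2 (by simp)))).2
  have hst' : ¬ (s.1 = t.1 ∧ s.2 = t.2) := fun h => hst (Prod.ext h.1 h.2)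
  have h1 := vertStep_spec α F x y
  have h2 := horizStep_spec α F x y
  have h3 := vertStep_spec α F x (y - 1)
  have h4 := horizStep_spec α F (x - 1) y
  rw [sub_add_cancel, F.adj_comm, key] at h3 h4
  rw [key] at h1 h2
  obtain ⟨s₁, s₂⟩ := s
  obtain ⟨t₁, t₂⟩ := t
  simp only at h1 h2 h3 h4 hs' ht' hst'
  clear key hs hst
  have hpar : (x + y + α) % 2 = 0 ∧ (x + (y - 1) + α) % 2 = 1 ∧ (x - 1 + y + α) % 2 = 1 ∨
      (x + y + α) % 2 = 1 ∧ (x + (y - 1) + α) % 2 = 0 ∧ (x - 1 + y + α) % 2 = 0 := by omega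
  rcases hpar with ⟨p1, p2, p3⟩ | ⟨p1, p2, p3⟩ <;>
    simp only [p1, p2, p3, one_ne_zero, iff_true, iff_false, not_not] at h1 h2 h3 h4 <;>
    rcases hs' with ⟨rfl, rfl⟩ | ⟨rfl, rfl⟩ | ⟨rfl, rfl⟩ | ⟨rfl, rfl⟩ <;>
    rcases ht' with ⟨rfl, rfl⟩ | ⟨rfl, rfl⟩ | ⟨rfl, rfl⟩ | ⟨rfl, rfl⟩ <;>
    omega

/-- Heights, summed up along the left side and then along a row. -/
noncomputable def height (α : ℤ) (F : SimpleGraph (ℤ × ℤ)) : ℕ → ℕ → ℤ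
  | 0, 0 => 0
  | 0, y + 1 => height α F 0 y - horizStep α F 0 (y + 1)
  | x + 1, y => height α F x y + vertStep α F (x + 1) y

/-- Path independence: the step holds by definition in column zero and `step_relation` carries it
from each column to the next. -/
theorem height_succ {n : ℕ} {F : SimpleGraph (ℤ × ℤ)} (hF : F ≤ board n)
    (h2 : ∀ v, IsGridVertex n v → (F.neighborSet v).ncard = 2) (α : ℤ) {x y : ℕ} (hx : x ≤ n)
    (hy : y < n) :
    height α F x (y + 1) = height α F x y - horizStep α F x (y + 1) := by
  induction x with
  | zero => simp [height]
  | succ x ih =>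
    have := step_relation hF α (h2 (x + 1, y + 1) (by simp only [IsGridVertex]; omega))
    simp only [add_sub_cancel_right] at this
    rw [height, height, ih (by omega)]
    push_cast
    linarith

theorem exists_isHeight {n : ℕ} {F : SimpleGraph (ℤ × ℤ)} (hF : F ≤ board n)
    (h2 : ∀ v, IsGridVertex n v → (F.neighborSet v).ncard = 2) (α : ℤ) :
    ∃ h, IsHeight n α F h ∧ h 0 0 = 0 := by
  have vs := vertStep_spec α F
  have hs := horizStep_spec α F
  refine ⟨fun x y => height α F x.toNat y.toNat, ⟨?_, ?_, ?_⟩, by simp [height]⟩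
  · intro x y hx hxn hy hyn
    obtain ⟨x, rfl⟩ : ∃ k : ℕ, x = k + 1 := ⟨(x - 1).toNat, by omega⟩
    obtain ⟨y, rfl⟩ : ∃ k : ℕ, y = k := ⟨y.toNat, by omega⟩
    have e : ((x : ℤ) + 1).toNat = x + 1 := by omega
    simp only [e, add_sub_cancel_right, Int.toNat_natCast, height]
    rcases vs (x + 1) y with ⟨h, h'⟩ | ⟨h, h'⟩
    · exact Or.inl ⟨h', by rw [h]⟩
    · exact Or.inr ⟨h', by rw [h]; ring⟩
  · intro x y hx hxn hy hyn
    obtain ⟨x, rfl⟩ : ∃ k : ℕ, x = k := ⟨x.toNat, by omega⟩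
    obtain ⟨y, rfl⟩ : ∃ k : ℕ, y = k + 1 := ⟨(y - 1).toNat, by omega⟩
    have e : ((y : ℤ) + 1).toNat = y + 1 := by omega
    simp only [e, add_sub_cancel_right, Int.toNat_natCast]
    rw [height_succ hF h2 α (by omega) (by omega)]
    rcases hs x (y + 1) with ⟨h, h'⟩ | ⟨h, h'⟩
    · exact Or.inl ⟨h', by rw [h]⟩
    · exact Or.inr ⟨h', by rw [h]; ring⟩
  · intro x y hx _ hy _
    obtain ⟨x, rfl⟩ : ∃ k : ℕ, x = k := ⟨x.toNat, by omega⟩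
    obtain ⟨y, rfl⟩ : ∃ k : ℕ, y = k := ⟨y.toNat, by omega⟩
    simp only [Int.toNat_natCast]
    clear hx hy
    induction x with
    | zero =>
      induction y with
      | zero => simp [height]
      | succ y ih =>
        specialize ih (by omega)
        rw [height]
        have := hs 0 (y + 1)
        push_cast
        omega
    | succ x ih =>
      specialize ih (by omega)
      rw [height]
      have := vs (x + 1) y
      push_cast
      omega

/-- Two height functions of configurations with the same occupied external edges agree on the
outer squares. -/
theorem IsHeight.eq_boundary {n : ℕ} {α : ℤ} {F G : SimpleGraph (ℤ × ℤ)} {h k : ℤ → ℤ → ℤ}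
    (hF : IsHeight n α F h) (hG : IsHeight n α G k) (h0 : h 0 0 = k 0 0)
    (hFG : ∀ o v, ¬ IsGridVertex n o → (F.Adj o v ↔ G.Adj o v)) {x y : ℤ} (hx : 0 ≤ x)
    (hxn : x ≤ n) (hy : 0 ≤ y) (hyn : y ≤ n) (hb : x = 0 ∨ x = n ∨ y = 0 ∨ y = n) :
    h x y = k x y := by
  have hv : ∀ x y : ℤ, 1 ≤ x → x ≤ n → (y = 0 ∨ y = n) → h (x - 1) y = k (x - 1) y →
      h x y = k x y := by
    intro x y hx hxn hy hxy
    have h1 := hF.vert x y hx hxn (by omega) (by omega)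
    have h2 := hG.vert x y hx hxn (by omega) (by omega)
    have : F.Adj (x, y) (x, y + 1) ↔ G.Adj (x, y) (x, y + 1) := by
      rcases hy with rfl | rfl
      · exact hFG _ _ (by simp [IsGridVertex])
      · rw [F.adj_comm, G.adj_comm]
        exact hFG _ _ (by simp [IsGridVertex])
    rw [this] at h1
    rcases h1 with h1 | h1 <;> rcases h2 with h2 | h2
    · omega
    · exact absurd h1.1 h2.1
    · exact absurd h2.1 h1.1
    · omega
  have hh : ∀ x y : ℤ, 1 ≤ y → y ≤ n → (x = 0 ∨ x = n) → h x (y - 1) = k x (y - 1) →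
      h x y = k x y := by
    intro x y hy hyn hx hxy
    have h1 := hF.horiz x y (by omega) (by omega) hy hyn
    have h2 := hG.horiz x y (by omega) (by omega) hy hyn
    have : F.Adj (x, y) (x + 1, y) ↔ G.Adj (x, y) (x + 1, y) := by
      rcases hx with rfl | rfl
      · exact hFG _ _ (by simp [IsGridVertex])
      · rw [F.adj_comm, G.adj_comm]
        exact hFG _ _ (by simp [IsGridVertex])
    rw [this] at h1
    rcases h1 with h1 | h1 <;> rcases h2 with h2 | h2
    · omega
    · exact absurd h1.1 h2.1
    · exact absurd h2.1 h1.1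
    · omega
  have left : ∀ m : ℕ, m ≤ n → h 0 m = k 0 m := by
    intro m
    induction m with
    | zero => intro _; simpa using h0
    | succ m ih =>
      intro hm
      exact hh _ _ (by omega) (by omega) (Or.inl rfl) (by simpa using ih (by omega))
  have rows : ∀ y : ℤ, (y = 0 ∨ y = n) → ∀ m : ℕ, m ≤ n → h m y = k m y := by
    intro y hy m
    induction m with
    | zero =>
      intro _
      have := left y.toNat (by omega)
      rwa [Int.toNat_of_nonneg (by omega)] at this
    | succ m ih =>
      intro hm
      exact hv _ _ (by omega) (by omega) hy (by simpa using ih (by omega))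
  have right : ∀ m : ℕ, m ≤ n → h n m = k n m := by
    intro m
    induction m with
    | zero => intro _; simpa using rows 0 (Or.inl rfl) n le_rfl
    | succ m ih =>
      intro hm
      exact hh _ _ (by omega) (by omega) (Or.inr rfl) (by simpa using ih (by omega))
  rw [← Int.toNat_of_nonneg hx, ← Int.toNat_of_nonneg hy]
  rcases hb with rfl | rfl | hb | hb
  · exact left _ (by omega)
  · exact right _ (by omega)
  · exact rows _ (by omega) _ (by omega)
  · exact rows _ (by omega) _ (by omega)

/-- A configuration is determined by its heights and its external edges. -/
theorem IsHeight.eq_of_eq {n : ℕ} {α : ℤ} {F G : SimpleGraph (ℤ × ℤ)} {h k : ℤ → ℤ → ℤ}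
    (hF : IsHeight n α F h) (hG : IsHeight n α G k) (hFb : F ≤ board n) (hGb : G ≤ board n)
    (hhk : ∀ x y : ℤ, 0 ≤ x → x ≤ n → 0 ≤ y → y ≤ n → h x y = k x y) : F = G := by
  have up : ∀ x y : ℤ, (board n).Adj (x, y) (x, y + 1) →
      (F.Adj (x, y) (x, y + 1) ↔ G.Adj (x, y) (x, y + 1)) := by
    intro x y hb
    have hb := (board_adj hb).1
    simp only [IsGridVertex] at hb
    have h1 := hF.vert x y (by omega) (by omega) (by omega) (by omega)
    have h2 := hG.vert x y (by omega) (by omega) (by omega) (by omega)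
    rw [hhk x y (by omega) (by omega) (by omega) (by omega),
      hhk (x - 1) y (by omega) (by omega) (by omega) (by omega)] at h1
    rcases h1 with h1 | h1 <;> rcases h2 with h2 | h2
    · exact h1.1.trans h2.1.symm
    · omega
    · omega
    · have := h1.1
      have := h2.1
      tauto
  have right : ∀ x y : ℤ, (board n).Adj (x, y) (x + 1, y) →
      (F.Adj (x, y) (x + 1, y) ↔ G.Adj (x, y) (x + 1, y)) := by
    intro x y hb
    have hb := (board_adj hb).1
    simp only [IsGridVertex] at hb
    have h1 := hF.horiz x y (by omega) (by omega) (by omega) (by omega)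
    have h2 := hG.horiz x y (by omega) (by omega) (by omega) (by omega)
    rw [hhk x y (by omega) (by omega) (by omega) (by omega),
      hhk x (y - 1) (by omega) (by omega) (by omega) (by omega)] at h1
    rcases h1 with h1 | h1 <;> rcases h2 with h2 | h2
    · exact h1.1.trans h2.1.symm
    · omega
    · omega
    · have := h1.1
      have := h2.1
      tauto
  have all : ∀ u v, (board n).Adj u v → (F.Adj u v ↔ G.Adj u v) := by
    rintro ⟨x, y⟩ ⟨x', y'⟩ hb
    have hd := (board_adj hb).2
    simp only at hd
    rcases hd with ⟨rfl, rfl⟩ | ⟨h1, rfl⟩ | ⟨rfl, rfl⟩ | ⟨rfl, h1⟩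
    · exact right _ _ hb
    · obtain rfl : x = x' + 1 := by omega
      rw [F.adj_comm, G.adj_comm]
      exact right _ _ hb.symm
    · exact up _ _ hb
    · obtain rfl : y = y' + 1 := by omega
      rw [F.adj_comm, G.adj_comm]
      exact up _ _ hb.symm
  ext u v
  exact ⟨fun h => (all u v (hFb h)).1 h, fun h => (all u v (hGb h)).2 h⟩

/-! ### Toggling the square of a peak -/

/-- The edges of the unit square with lower left corner `(x, y)`. -/
def cell (x y : ℤ) : Set (Sym2 (ℤ × ℤ)) :=
  {s((x, y), (x + 1, y)), s((x, y + 1), (x + 1, y + 1)), s((x, y), (x, y + 1)),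
    s((x + 1, y), (x + 1, y + 1))}

/-- Exchange the occupied and the unoccupied edges of a unit square. -/
def toggle (F : SimpleGraph (ℤ × ℤ)) (x y : ℤ) : SimpleGraph (ℤ × ℤ) where
  Adj u v := F.Adj u v ↔ s(u, v) ∉ cell x y
  symm := ⟨fun u v h => by rwa [F.adj_comm, Sym2.eq_swap]⟩
  loopless := ⟨fun u h => by
    have hu : s(u, u) ∉ cell x y := by
      simp only [cell, Set.mem_insert_iff, Set.mem_singleton_iff, Sym2.eq_iff, Prod.ext_iff]
      omega
    exact F.irrefl (h.2 hu)⟩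

/-- Lower the height of one unit square by two. -/
def lower (h : ℤ → ℤ → ℤ) (x y : ℤ) (x' y' : ℤ) : ℤ :=
  if x' = x ∧ y' = y then h x y - 2 else h x' y'

/-- The height is larger than in the four neighbouring unit squares. -/
def IsPeak (h : ℤ → ℤ → ℤ) (x y : ℤ) : Prop :=
  h (x - 1) y = h x y - 1 ∧ h (x + 1) y = h x y - 1 ∧ h x (y - 1) = h x y - 1 ∧
    h x (y + 1) = h x y - 1

theorem toggle_adj {F : SimpleGraph (ℤ × ℤ)} {x y : ℤ} {u v : ℤ × ℤ} :
    (toggle F x y).Adj u v ↔ (F.Adj u v ↔ s(u, v) ∉ cell x y) := Iff.rfl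

theorem vert_mem_cell {x y a b : ℤ} :
    s((a, b), (a, b + 1)) ∈ cell x y ↔ (a = x ∨ a = x + 1) ∧ b = y := by
  simp only [cell, Set.mem_insert_iff, Set.mem_singleton_iff, Sym2.eq_iff, Prod.mk.injEq]
  omega

theorem horiz_mem_cell {x y a b : ℤ} :
    s((a, b), (a + 1, b)) ∈ cell x y ↔ a = x ∧ (b = y ∨ b = y + 1) := by
  simp only [cell, Set.mem_insert_iff, Set.mem_singleton_iff, Sym2.eq_iff, Prod.mk.injEq]
  omega

theorem lower_spec (h : ℤ → ℤ → ℤ) (x y a b : ℤ) :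
    ((a = x ∧ b = y) ∧ lower h x y a b = h a b - 2) ∨
      (¬ (a = x ∧ b = y) ∧ lower h x y a b = h a b) := by
  unfold lower
  split_ifs with hab
  · obtain ⟨rfl, rfl⟩ := hab
    simp
  · exact Or.inr ⟨hab, rfl⟩

theorem IsPeak.lower_vert {h : ℤ → ℤ → ℤ} {x y a b : ℤ} (hp : IsPeak h x y)
    (hab : (a = x ∨ a = x + 1) ∧ b = y) :
    lower h x y a b - lower h x y (a - 1) b = -(h a b - h (a - 1) b) := by
  obtain ⟨p1, p2, -, -⟩ := hp
  obtain ⟨rfl | rfl, rfl⟩ := hab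
  · have h1 : lower h a b a b = h a b - 2 := by simp [lower]
    have h2 : lower h a b (a - 1) b = h (a - 1) b := by simp [lower]
    rw [h1, h2, p1]
    ring
  · have h1 : lower h x b x b = h x b - 2 := by simp [lower]
    have h2 : lower h x b (x + 1) b = h (x + 1) b := by simp [lower]
    rw [add_sub_cancel_right, h1, h2, p2]
    ring

theorem IsPeak.lower_horiz {h : ℤ → ℤ → ℤ} {x y a b : ℤ} (hp : IsPeak h x y)
    (hab : a = x ∧ (b = y ∨ b = y + 1)) :
    lower h x y a b - lower h x y a (b - 1) = -(h a b - h a (b - 1)) := by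
  obtain ⟨-, -, p1, p2⟩ := hp
  obtain ⟨rfl, rfl | rfl⟩ := hab
  · have h1 : lower h a b a b = h a b - 2 := by simp [lower]
    have h2 : lower h a b a (b - 1) = h a (b - 1) := by simp [lower]
    rw [h1, h2, p1]
    ring
  · have h1 : lower h a y a y = h a y - 2 := by simp [lower]
    have h2 : lower h a y a (y + 1) = h a (y + 1) := by simp [lower]
    rw [add_sub_cancel_right, h1, h2, p2]
    ring

section
variable {n : ℕ} {α : ℤ} {F G : SimpleGraph (ℤ × ℤ)} {h : ℤ → ℤ → ℤ} {x y : ℤ}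

/-- Lowering a peak by two reverses the height step across each of its four edges, and a reversed
step is an exchanged occupation. -/
theorem IsHeight.toggle (hF : IsHeight n α F h) (hp : IsPeak h x y) :
    IsHeight n α (toggle F x y) (lower h x y) := by
  refine ⟨fun a b ha han hb hbn => ?_, fun a b ha han hb hbn => ?_, fun a b ha han hb hbn => ?_⟩
  · have l1 := lower_spec h x y a b
    have l2 := lower_spec h x y (a - 1) b
    have hm := vert_mem_cell (x := x) (y := y) (a := a) (b := b)
    by_cases hc : s((a, b), (a, b + 1)) ∈ cell x y
    · have ht : (FPL.toggle F x y).Adj (a, b) (a, b + 1) ↔ ¬ F.Adj (a, b) (a, b + 1) := by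
        rw [toggle_adj]
        tauto
      have hab := hm.1 hc
      have hd := hp.lower_vert hab
      clear l1 l2
      rw [ht]
      rcases hF.vert a b ha han hb hbn with ⟨h1, h2⟩ | ⟨h1, h2⟩
      · exact Or.inr ⟨by tauto, by omega⟩
      · exact Or.inl ⟨by tauto, by omega⟩
    · have ht : (FPL.toggle F x y).Adj (a, b) (a, b + 1) ↔ F.Adj (a, b) (a, b + 1) := by
        rw [toggle_adj]
        tauto
      have hab := (not_congr hm).1 hc
      have e1 : lower h x y a b = h a b := by omega
      have e2 : lower h x y (a - 1) b = h (a - 1) b := by omega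
      rw [ht, e1, e2]
      exact hF.vert a b ha han hb hbn
  · have l1 := lower_spec h x y a b
    have l2 := lower_spec h x y a (b - 1)
    have hm := horiz_mem_cell (x := x) (y := y) (a := a) (b := b)
    by_cases hc : s((a, b), (a + 1, b)) ∈ cell x y
    · have ht : (FPL.toggle F x y).Adj (a, b) (a + 1, b) ↔ ¬ F.Adj (a, b) (a + 1, b) := by
        rw [toggle_adj]
        tauto
      have hab := hm.1 hc
      have hd := hp.lower_horiz hab
      clear l1 l2
      rw [ht]
      rcases hF.horiz a b ha han hb hbn with ⟨h1, h2⟩ | ⟨h1, h2⟩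
      · exact Or.inr ⟨by tauto, by omega⟩
      · exact Or.inl ⟨by tauto, by omega⟩
    · have ht : (FPL.toggle F x y).Adj (a, b) (a + 1, b) ↔ F.Adj (a, b) (a + 1, b) := by
        rw [toggle_adj]
        tauto
      have hab := (not_congr hm).1 hc
      have e1 : lower h x y a b = h a b := by omega
      have e2 : lower h x y a (b - 1) = h a (b - 1) := by omega
      rw [ht, e1, e2]
      exact hF.horiz a b ha han hb hbn
  · have hv := hF.parity a b ha han hb hbn
    have l1 := lower_spec h x y a b
    omega

/-- Around a peak, either the two horizontal or the two vertical edges are occupied. -/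
theorem IsHeight.adj_of_isPeak (hF : IsHeight n α F h) (hp : IsPeak h x y) (hx : 0 < x)
    (hxn : x < n) (hy : 0 < y) (hyn : y < n) :
    (F.Adj (x, y) (x + 1, y) ↔ (x + y + α) % 2 = 1) ∧
    (F.Adj (x, y + 1) (x + 1, y + 1) ↔ (x + y + α) % 2 = 1) ∧
    (F.Adj (x, y) (x, y + 1) ↔ (x + y + α) % 2 = 0) ∧
    (F.Adj (x + 1, y) (x + 1, y + 1) ↔ (x + y + α) % 2 = 0) := by
  obtain ⟨p1, p2, p3, p4⟩ := hp
  have h1 := hF.horiz x y (by omega) (by omega) (by omega) (by omega)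
  have h2 := hF.horiz x (y + 1) (by omega) (by omega) (by omega) (by omega)
  have h3 := hF.vert x y (by omega) (by omega) (by omega) (by omega)
  have h4 := hF.vert (x + 1) y (by omega) (by omega) (by omega) (by omega)
  rw [add_sub_cancel_right] at h2 h4
  refine ⟨?_, ?_, ?_, ?_⟩
  · by_cases hA : F.Adj (x, y) (x + 1, y) <;> simp only [hA, true_iff, false_iff] at h1 ⊢ <;> omega
  · by_cases hA : F.Adj (x, y + 1) (x + 1, y + 1) <;>
      simp only [hA, true_iff, false_iff] at h2 ⊢ <;> omega
  · by_cases hA : F.Adj (x, y) (x, y + 1) <;> simp only [hA, true_iff, false_iff] at h3 ⊢ <;> omega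
  · by_cases hA : F.Adj (x + 1, y) (x + 1, y + 1) <;>
      simp only [hA, true_iff, false_iff] at h4 ⊢ <;> omega

/-! ### Domino moves as pairs of toggles -/

theorem dominoFlip_of_toggle {p e f : ℤ × ℤ} (hv : ∀ v ∈ dominoVertices p e f, IsGridVertex n v)
    (hm : dominoMiddle p e f ∈ F.edgeSet) (h₁ : ∀ E ∈ dominoBorder₁ p e f, E ∈ F.edgeSet)
    (h₂ : ∀ E ∈ dominoBorder₂ p e f, E ∉ F.edgeSet)
    (hG : ∀ E, E ∈ G.edgeSet ↔
      (E ∈ F.edgeSet ↔ ¬ (E ∈ dominoBorder₁ p e f ∨ E ∈ dominoBorder₂ p e f))) :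
    DominoFlip n p e f F G := by
  refine ⟨hv, hm, h₁, Set.disjoint_left.2 h₂, ?_⟩
  ext E
  have := h₁ E
  have := h₂ E
  rw [hG, Set.mem_union, Set.mem_sdiff]
  by_cases E ∈ dominoBorder₁ p e f <;> by_cases E ∈ dominoBorder₂ p e f <;> simp_all

/-- When the second triple is the occupied one, the exchange is a flip read backwards, from `G` to
`F`. -/
theorem dominoFlip_of_toggle' {p e f : ℤ × ℤ} (hv : ∀ v ∈ dominoVertices p e f, IsGridVertex n v)
    (hm : dominoMiddle p e f ∈ F.edgeSet) (h₁ : ∀ E ∈ dominoBorder₁ p e f, E ∉ F.edgeSet)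
    (h₂ : ∀ E ∈ dominoBorder₂ p e f, E ∈ F.edgeSet)
    (hm' : dominoMiddle p e f ∉ dominoBorder₂ p e f)
    (hG : ∀ E, E ∈ G.edgeSet ↔
      (E ∈ F.edgeSet ↔ ¬ (E ∈ dominoBorder₁ p e f ∨ E ∈ dominoBorder₂ p e f))) :
    DominoFlip n p e f G F := by
  refine ⟨hv, ?_, fun E hE => ?_, Set.disjoint_left.2 fun E hE => ?_, ?_⟩
  · have := h₁ (dominoMiddle p e f)
    rw [hG]
    tauto
  · have := h₁ E hE
    rw [hG]
    tauto
  · have := h₂ E hE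
    rw [hG]
    tauto
  · ext E
    have := h₁ E
    have := h₂ E
    rw [Set.mem_union, Set.mem_sdiff, hG]
    by_cases E ∈ dominoBorder₁ p e f <;> by_cases E ∈ dominoBorder₂ p e f <;> simp_all

theorem mem_edgeSet_toggle {E : Sym2 (ℤ × ℤ)} :
    E ∈ (toggle F x y).edgeSet ↔ (E ∈ F.edgeSet ↔ E ∉ cell x y) := by
  induction E with
  | _ u v => exact toggle_adj

/-- The two alternating triples of border edges of a vertical domino. -/
theorem mem_toggle_vertical {E : Sym2 (ℤ × ℤ)} :
    (E ∈ cell x y ↔ E ∉ cell x (y + 1)) ↔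
      (E ∈ dominoBorder₁ (x, y) (1, 0) (0, 1) ∨ E ∈ dominoBorder₂ (x, y) (1, 0) (0, 1)) := by
  simp only [cell, dominoBorder₁, dominoBorder₂, Prod.mk_add_mk, Prod.smul_mk, add_zero,
    Set.mem_insert_iff, Set.mem_singleton_iff, nsmul_eq_mul, Nat.cast_ofNat, mul_zero, mul_one,
    add_assoc, one_add_one_eq_two]
  by_cases hE : E = s((x, y), (x + 1, y)) ∨ E = s((x, y + 1), (x + 1, y + 1)) ∨
      E = s((x, y), (x, y + 1)) ∨ E = s((x + 1, y), (x + 1, y + 1))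
  · rcases hE with rfl | rfl | rfl | rfl <;> simp
  · simp only [not_or] at hE
    simp [hE]
    tauto

/-- The two alternating triples of border edges of a horizontal domino. -/
theorem mem_toggle_horizontal {E : Sym2 (ℤ × ℤ)} :
    (E ∈ cell x y ↔ E ∉ cell (x + 1) y) ↔
      (E ∈ dominoBorder₁ (x, y) (0, 1) (1, 0) ∨ E ∈ dominoBorder₂ (x, y) (0, 1) (1, 0)) := by
  simp only [cell, dominoBorder₁, dominoBorder₂, Prod.mk_add_mk, Prod.smul_mk, add_zero,
    Set.mem_insert_iff, Set.mem_singleton_iff, nsmul_eq_mul, Nat.cast_ofNat, mul_zero, mul_one,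
    add_assoc, one_add_one_eq_two]
  by_cases hE : E = s((x, y), (x + 1, y)) ∨ E = s((x, y + 1), (x + 1, y + 1)) ∨
      E = s((x, y), (x, y + 1)) ∨ E = s((x + 1, y), (x + 1, y + 1))
  · rcases hE with rfl | rfl | rfl | rfl <;> simp
  · simp only [not_or] at hE
    simp [hE]
    tauto

end

/-- Associativity of the symmetric difference: two toggles exchange the edges lying in exactly one
of the squares, and leave the middle edge alone. -/
theorem iff_not_assoc {a b c : Prop} : ((a ↔ ¬ b) ↔ ¬ c) ↔ (a ↔ ¬ (b ↔ ¬ c)) := by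
  by_cases a <;> by_cases b <;> by_cases c <;> simp [*]

theorem iff_not_assoc' {a b c : Prop} : ((a ↔ ¬ b) ↔ ¬ c) ↔ (a ↔ ¬ (c ↔ ¬ b)) := by
  by_cases a <;> by_cases b <;> by_cases c <;> simp [*]

theorem border_vertical (x y : ℤ) :
    dominoMiddle (x, y) (1, 0) (0, 1) = s((x, y + 1), (x + 1, y + 1)) ∧
    dominoBorder₁ (x, y) (1, 0) (0, 1) =
      {s((x, y), (x + 1, y)), s((x, y + 1), (x, y + 1 + 1)),
        s((x + 1, y + 1), (x + 1, y + 1 + 1))} ∧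
    dominoBorder₂ (x, y) (1, 0) (0, 1) =
      {s((x, y + 1 + 1), (x + 1, y + 1 + 1)), s((x, y), (x, y + 1)),
        s((x + 1, y), (x + 1, y + 1))} := by
  simp [dominoMiddle, dominoBorder₁, dominoBorder₂, add_assoc]

theorem border_horizontal (x y : ℤ) :
    dominoMiddle (x, y) (0, 1) (1, 0) = s((x + 1, y), (x + 1, y + 1)) ∧
    dominoBorder₁ (x, y) (0, 1) (1, 0) =
      {s((x, y), (x, y + 1)), s((x + 1, y), (x + 1 + 1, y)),
        s((x + 1, y + 1), (x + 1 + 1, y + 1))} ∧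
    dominoBorder₂ (x, y) (0, 1) (1, 0) =
      {s((x + 1 + 1, y), (x + 1 + 1, y + 1)), s((x, y), (x + 1, y)),
        s((x, y + 1), (x + 1, y + 1))} := by
  simp [dominoMiddle, dominoBorder₁, dominoBorder₂, add_assoc]

theorem isGridVertex_of_mem_vertical {n : ℕ} {x y : ℤ} (hx : 0 < x) (hxn : x < n) (hy : 0 < y)
    (hyn : y + 1 < n) : ∀ v ∈ dominoVertices (x, y) (1, 0) (0, 1), IsGridVertex n v := by
  intro v hv
  rw [mem_dominoVertices] at hv
  rcases hv with rfl | rfl | rfl | rfl | rfl | rfl <;>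
    simp only [IsGridVertex, Prod.mk_add_mk, Prod.smul_mk, nsmul_eq_mul, Nat.cast_ofNat] <;> omega

theorem isGridVertex_of_mem_horizontal {n : ℕ} {x y : ℤ} (hx : 0 < x) (hxn : x + 1 < n)
    (hy : 0 < y) (hyn : y < n) : ∀ v ∈ dominoVertices (x, y) (0, 1) (1, 0), IsGridVertex n v := by
  intro v hv
  rw [mem_dominoVertices] at hv
  rcases hv with rfl | rfl | rfl | rfl | rfl | rfl <;>
    simp only [IsGridVertex, Prod.mk_add_mk, Prod.smul_mk, nsmul_eq_mul, Nat.cast_ofNat] <;> omega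

section
variable {n : ℕ} {α : ℤ} {F : SimpleGraph (ℤ × ℤ)} {h : ℤ → ℤ → ℤ} {x y : ℤ}

/-- The middle edge must be occupied before the first toggle. Odd peaks have occupied horizontal
edges and even peaks occupied vertical ones, so vertical dominoes start at an odd square and
horizontal dominoes at an even one. -/
theorem IsHeight.dominoMove_up (hF : IsHeight n α F h) (hp : IsPeak h x y)
    (hp' : IsPeak (lower h x y) x (y + 1)) (hx : 0 < x) (hxn : x < n) (hy : 0 < y)
    (hyn : y + 1 < n)
    (hc : (x + y + α) % 2 = 1) :
    DominoMove n F (FPL.toggle (FPL.toggle F x y) x (y + 1)) := by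
  have a := hF.adj_of_isPeak hp (by omega) (by omega) (by omega) (by omega)
  have a' := (hF.toggle hp).adj_of_isPeak hp' (by omega) (by omega) (by omega) (by omega)
  simp only [toggle_adj, vert_mem_cell, horiz_mem_cell] at a'
  obtain ⟨hmid, hb₁, hb₂⟩ := border_vertical x y
  obtain ⟨a1, a2, a3, a4⟩ := a
  obtain ⟨b1, b2, b3, b4⟩ := a'
  refine ⟨(x, y), Or.inl (Or.inl ?_)⟩
  refine dominoFlip_of_toggle (isGridVertex_of_mem_vertical hx hxn hy hyn) ?_ ?_ ?_ ?_
  · rw [hmid, mem_edgeSet]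
    exact a2.2 (by omega)
  · rw [hb₁]
    rintro E (rfl | rfl | rfl)
    · exact a1.2 (by omega)
    · exact ((b3.2 (by omega)).2 (by omega))
    · exact ((b4.2 (by omega)).2 (by omega))
  · rw [hb₂]
    rintro E (rfl | rfl | rfl)
    · exact fun hE => by have := b2.1 (iff_of_true hE (by omega)); omega
    · exact fun hE => by have := a3.1 hE; omega
    · exact fun hE => by have := a4.1 hE; omega
  · intro E
    rw [mem_edgeSet_toggle, mem_edgeSet_toggle, ← mem_toggle_vertical]
    exact iff_not_assoc

theorem IsHeight.dominoMove_down (hF : IsHeight n α F h) (hp : IsPeak h x (y + 1))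
    (hp' : IsPeak (lower h x (y + 1)) x y) (hx : 0 < x) (hxn : x < n) (hy : 0 < y)
    (hyn : y + 1 < n)
    (hc : (x + y + α) % 2 = 0) :
    DominoMove n F (FPL.toggle (FPL.toggle F x (y + 1)) x y) := by
  have a := hF.adj_of_isPeak hp (by omega) (by omega) (by omega) (by omega)
  have a' := (hF.toggle hp).adj_of_isPeak hp' (by omega) (by omega) (by omega) (by omega)
  simp only [toggle_adj, vert_mem_cell, horiz_mem_cell] at a'
  obtain ⟨hmid, hb₁, hb₂⟩ := border_vertical x y
  obtain ⟨a1, a2, a3, a4⟩ := a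
  obtain ⟨b1, b2, b3, b4⟩ := a'
  refine ⟨(x, y), Or.inl (Or.inr ?_)⟩
  refine dominoFlip_of_toggle' (isGridVertex_of_mem_vertical hx hxn hy hyn) ?_ ?_ ?_ ?_ ?_
  · rw [hmid, mem_edgeSet]
    exact a1.2 (by omega)
  · rw [hb₁]
    rintro E (rfl | rfl | rfl)
    · exact fun hE => by have := b1.1 (iff_of_true hE (by omega)); omega
    · exact fun hE => by have := a3.1 hE; omega
    · exact fun hE => by have := a4.1 hE; omega
  · rw [hb₂]
    rintro E (rfl | rfl | rfl)
    · exact a2.2 (by omega)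
    · exact ((b3.2 (by omega)).2 (by omega))
    · exact ((b4.2 (by omega)).2 (by omega))
  · rw [hmid, hb₂]
    simp
  · intro E
    rw [mem_edgeSet_toggle, mem_edgeSet_toggle, ← mem_toggle_vertical]
    exact iff_not_assoc'

theorem IsHeight.dominoMove_right (hF : IsHeight n α F h) (hp : IsPeak h x y)
    (hp' : IsPeak (lower h x y) (x + 1) y) (hx : 0 < x) (hxn : x + 1 < n) (hy : 0 < y)
    (hyn : y < n)
    (hc : (x + y + α) % 2 = 0) :
    DominoMove n F (FPL.toggle (FPL.toggle F x y) (x + 1) y) := by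
  have a := hF.adj_of_isPeak hp (by omega) (by omega) (by omega) (by omega)
  have a' := (hF.toggle hp).adj_of_isPeak hp' (by omega) (by omega) (by omega) (by omega)
  simp only [toggle_adj, vert_mem_cell, horiz_mem_cell] at a'
  obtain ⟨hmid, hb₁, hb₂⟩ := border_horizontal x y
  obtain ⟨a1, a2, a3, a4⟩ := a
  obtain ⟨b1, b2, b3, b4⟩ := a'
  refine ⟨(x, y), Or.inr (Or.inl ?_)⟩
  refine dominoFlip_of_toggle (isGridVertex_of_mem_horizontal hx hxn hy hyn) ?_ ?_ ?_ ?_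
  · rw [hmid, mem_edgeSet]
    exact a4.2 (by omega)
  · rw [hb₁]
    rintro E (rfl | rfl | rfl)
    · exact a3.2 (by omega)
    · exact ((b1.2 (by omega)).2 (by omega))
    · exact ((b2.2 (by omega)).2 (by omega))
  · rw [hb₂]
    rintro E (rfl | rfl | rfl)
    · exact fun hE => by have := b4.1 (iff_of_true hE (by omega)); omega
    · exact fun hE => by have := a1.1 hE; omega
    · exact fun hE => by have := a2.1 hE; omega
  · intro E
    rw [mem_edgeSet_toggle, mem_edgeSet_toggle, ← mem_toggle_horizontal]
    exact iff_not_assoc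

theorem IsHeight.dominoMove_left (hF : IsHeight n α F h) (hp : IsPeak h (x + 1) y)
    (hp' : IsPeak (lower h (x + 1) y) x y) (hx : 0 < x) (hxn : x + 1 < n) (hy : 0 < y)
    (hyn : y < n)
    (hc : (x + y + α) % 2 = 1) :
    DominoMove n F (FPL.toggle (FPL.toggle F (x + 1) y) x y) := by
  have a := hF.adj_of_isPeak hp (by omega) (by omega) (by omega) (by omega)
  have a' := (hF.toggle hp).adj_of_isPeak hp' (by omega) (by omega) (by omega) (by omega)
  simp only [toggle_adj, vert_mem_cell, horiz_mem_cell] at a'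
  obtain ⟨hmid, hb₁, hb₂⟩ := border_horizontal x y
  obtain ⟨a1, a2, a3, a4⟩ := a
  obtain ⟨b1, b2, b3, b4⟩ := a'
  refine ⟨(x, y), Or.inr (Or.inr ?_)⟩
  refine dominoFlip_of_toggle' (isGridVertex_of_mem_horizontal hx hxn hy hyn) ?_ ?_ ?_ ?_ ?_
  · rw [hmid, mem_edgeSet]
    exact a3.2 (by omega)
  · rw [hb₁]
    rintro E (rfl | rfl | rfl)
    · exact fun hE => by have := b3.1 (iff_of_true hE (by omega)); omega
    · exact fun hE => by have := a1.1 hE; omega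
    · exact fun hE => by have := a2.1 hE; omega
  · rw [hb₂]
    rintro E (rfl | rfl | rfl)
    · exact a4.2 (by omega)
    · exact ((b1.2 (by omega)).2 (by omega))
    · exact ((b2.2 (by omega)).2 (by omega))
  · rw [hmid, hb₂]
    simp
  · intro E
    rw [mem_edgeSet_toggle, mem_edgeSet_toggle, ← mem_toggle_horizontal]
    exact iff_not_assoc'

end

/-! ### Comparison of two height functions -/

/-- A unit square in which the height `h` exceeds the height `k`. -/
def Above (n : ℕ) (h k : ℤ → ℤ → ℤ) (x y : ℤ) : Prop :=
  0 ≤ x ∧ x ≤ n ∧ 0 ≤ y ∧ y ≤ n ∧ k x y < h x y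

/-- A unit square of maximal height `h` among those in which `h` exceeds `k`. -/
def IsTop (n : ℕ) (h k : ℤ → ℤ → ℤ) (x y : ℤ) : Prop :=
  Above n h k x y ∧ ∀ x' y', Above n h k x' y' → h x' y' ≤ h x y

/-- Two heights agree on the outer squares. -/
def EqBoundary (n : ℕ) (h k : ℤ → ℤ → ℤ) : Prop :=
  ∀ x y : ℤ, 0 ≤ x → x ≤ n → 0 ≤ y → y ≤ n → (x = 0 ∨ x = n ∨ y = 0 ∨ y = n) → h x y = k x y

theorem exists_extremal {n : ℕ} {Q : ℤ → ℤ → Prop} (φ : ℤ → ℤ → ℤ)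
    (hQ : ∀ x y, Q x y → 0 ≤ x ∧ x ≤ n ∧ 0 ≤ y ∧ y ≤ n) (hne : ∃ x y, Q x y) :
    ∃ x y, Q x y ∧ ∀ x' y', Q x' y' → φ x' y' ≤ φ x y := by
  have hfin : {v : ℤ × ℤ | Q v.1 v.2}.Finite := by
    refine ((Set.finite_Icc (0 : ℤ) n).prod (Set.finite_Icc (0 : ℤ) n)).subset fun v hv => ?_
    obtain ⟨h1, h2, h3, h4⟩ := hQ _ _ hv
    exact ⟨⟨h1, h2⟩, ⟨h3, h4⟩⟩
  obtain ⟨x, y, hxy⟩ := hne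
  obtain ⟨v, hv, hmax⟩ := Set.exists_max_image _ (fun v : ℤ × ℤ => φ v.1 v.2) hfin ⟨(x, y), hxy⟩
  exact ⟨v.1, v.2, hv, fun x' y' h' => hmax (x', y') h'⟩

/-- Pigeonhole for the three centres: on one side of a diagonal there is at most one. -/
theorem subsingleton_or_compl (p : Fin 3 → Prop) :
    (∀ i j, p i → p j → i = j) ∨ (∀ i j, ¬ p i → ¬ p j → i = j) := by
  by_contra! h
  obtain ⟨⟨i, j, hi, hj, hij⟩, ⟨k, l, hk, hl, hkl⟩⟩ := h
  have h1 : i ≠ k := by rintro rfl; exact hk hi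
  have h2 : i ≠ l := by rintro rfl; exact hl hi
  have h3 : j ≠ k := by rintro rfl; exact hk hj
  have h4 : j ≠ l := by rintro rfl; exact hl hj
  omega

section
variable {n : ℕ} {α : ℤ} {F G : SimpleGraph (ℤ × ℤ)} {h k : ℤ → ℤ → ℤ} {x y x' y' : ℤ}

theorem IsHeight.step (hF : IsHeight n α F h) (hx : 0 ≤ x) (hxn : x ≤ n) (hy : 0 ≤ y) (hyn : y ≤ n)
    (hx' : 0 ≤ x') (hxn' : x' ≤ n) (hy' : 0 ≤ y') (hyn' : y' ≤ n)
    (hd : (x' = x + 1 ∧ y' = y) ∨ (x' = x - 1 ∧ y' = y) ∨ (x' = x ∧ y' = y + 1) ∨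
      (x' = x ∧ y' = y - 1)) : h x' y' = h x y + 1 ∨ h x' y' = h x y - 1 := by
  rcases hd with ⟨rfl, rfl⟩ | ⟨rfl, rfl⟩ | ⟨rfl, rfl⟩ | ⟨rfl, rfl⟩
  · have := hF.vert (x + 1) y' (by omega) hxn' hy hyn
    rw [add_sub_cancel_right] at this
    omega
  · have := hF.vert x y' (by omega) hxn hy hyn
    omega
  · have := hF.horiz x' (y + 1) hx hxn (by omega) hyn'
    rw [add_sub_cancel_right] at this
    omega
  · have := hF.horiz x' y hx hxn (by omega) hyn
    omega

/-- Across an edge common to both configurations the two heights jump alike, so an excess of `h`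
over `k` is passed on unchanged. -/
theorem IsHeight.sub_eq_of_vert (hF : IsHeight n α F h) (hG : IsHeight n α G k) (hx : 1 ≤ x)
    (hxn : x ≤ n) (hy : 0 ≤ y) (hyn : y ≤ n) (eF : F.Adj (x, y) (x, y + 1))
    (eG : G.Adj (x, y) (x, y + 1)) : h x y - h (x - 1) y = k x y - k (x - 1) y := by
  have h1 := hF.vert x y hx hxn hy hyn
  have h2 := hG.vert x y hx hxn hy hyn
  simp only [eF, eG, true_iff] at h1 h2
  omega

theorem IsHeight.sub_eq_of_horiz (hF : IsHeight n α F h) (hG : IsHeight n α G k) (hx : 0 ≤ x)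
    (hxn : x ≤ n) (hy : 1 ≤ y) (hyn : y ≤ n) (eF : F.Adj (x, y) (x + 1, y))
    (eG : G.Adj (x, y) (x + 1, y)) : h x y - h x (y - 1) = k x y - k x (y - 1) := by
  have h1 := hF.horiz x y hx hxn hy hyn
  have h2 := hG.horiz x y hx hxn hy hyn
  simp only [eF, eG, true_iff] at h1 h2
  omega

theorem Above.interior (hb : EqBoundary n h k) (ha : Above n h k x y) :
    0 < x ∧ x < n ∧ 0 < y ∧ y < n := by
  obtain ⟨h1, h2, h3, h4, h5⟩ := ha
  have := hb x y h1 h2 h3 h4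
  omega

/-- If `h` does not fall then it rises by one, and `k` rises by at most one, so the excess persists.
-/
theorem Above.of_step (hF : IsHeight n α F h) (hG : IsHeight n α G k) (hb : EqBoundary n h k)
    (ha : Above n h k x y)
    (hd : (x' = x + 1 ∧ y' = y) ∨ (x' = x - 1 ∧ y' = y) ∨ (x' = x ∧ y' = y + 1) ∨
      (x' = x ∧ y' = y - 1)) (hh : h x' y' ≠ h x y - 1) :
    Above n h k x' y' ∧ h x' y' = h x y + 1 := by
  have hi := ha.interior hb
  obtain ⟨h1, h2, h3, h4, h5⟩ := ha
  have r : 0 ≤ x' ∧ x' ≤ n ∧ 0 ≤ y' ∧ y' ≤ n := by omega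
  have s1 := hF.step h1 h2 h3 h4 r.1 r.2.1 r.2.2.1 r.2.2.2 hd
  have s2 := hG.step h1 h2 h3 h4 r.1 r.2.1 r.2.2.1 r.2.2.2 hd
  exact ⟨⟨r.1, r.2.1, r.2.2.1, r.2.2.2, by omega⟩, by omega⟩

theorem IsTop.isPeak (hF : IsHeight n α F h) (hG : IsHeight n α G k) (hb : EqBoundary n h k)
    (ht : IsTop n h k x y) : IsPeak h x y := by
  have key : ∀ x' y', ((x' = x + 1 ∧ y' = y) ∨ (x' = x - 1 ∧ y' = y) ∨ (x' = x ∧ y' = y + 1) ∨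
      (x' = x ∧ y' = y - 1)) → h x' y' = h x y - 1 := by
    intro x' y' hd
    by_contra hh
    obtain ⟨ha, he⟩ := ht.1.of_step hF hG hb hd hh
    have := ht.2 _ _ ha
    omega
  exact ⟨key _ _ (by omega), key _ _ (by omega), key _ _ (by omega), key _ _ (by omega)⟩

/-- Next to a square of maximal height, a square across a common edge of `F` and `G` either
becomes a peak once the first square is lowered, or has another neighbour of maximal height. -/
theorem IsTop.isPeak_or_exists (hF : IsHeight n α F h) (hG : IsHeight n α G k)
    (hb : EqBoundary n h k) (ht : IsTop n h k x y)
    (hd : (x' = x + 1 ∧ y' = y) ∨ (x' = x - 1 ∧ y' = y) ∨ (x' = x ∧ y' = y + 1) ∨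
      (x' = x ∧ y' = y - 1)) (ha : Above n h k x' y') :
    IsPeak (lower h x y) x' y' ∨ ∃ u v, IsTop n h k u v ∧ ¬ (u = x ∧ v = y) ∧
      ((u = x' + 1 ∧ v = y') ∨ (u = x' - 1 ∧ v = y') ∨ (u = x' ∧ v = y' + 1) ∨
        (u = x' ∧ v = y' - 1)) := by
  have hp := ht.isPeak hF hG hb
  have hxy : h x' y' = h x y - 1 := by
    obtain ⟨p1, p2, p3, p4⟩ := hp
    rcases hd with ⟨rfl, rfl⟩ | ⟨rfl, rfl⟩ | ⟨rfl, rfl⟩ | ⟨rfl, rfl⟩ <;> assumption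
  by_cases hall : ∀ u v, ((u = x' + 1 ∧ v = y') ∨ (u = x' - 1 ∧ v = y') ∨ (u = x' ∧ v = y' + 1) ∨
      (u = x' ∧ v = y' - 1)) → ¬ (u = x ∧ v = y) → h u v = h x' y' - 1
  · left
    have key : ∀ u v, ((u = x' + 1 ∧ v = y') ∨ (u = x' - 1 ∧ v = y') ∨ (u = x' ∧ v = y' + 1) ∨
        (u = x' ∧ v = y' - 1)) → lower h x y u v = lower h x y x' y' - 1 := by
      intro u v huv
      have l1 := lower_spec h x y x' y'
      have l2 := lower_spec h x y u v
      by_cases hc : u = x ∧ v = y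
      · obtain ⟨rfl, rfl⟩ := hc
        omega
      · have := hall u v huv hc
        omega
    exact ⟨key _ _ (by omega), key _ _ (by omega), key _ _ (by omega), key _ _ (by omega)⟩
  · right
    push Not at hall
    obtain ⟨u, v, huv, hne, hh⟩ := hall
    obtain ⟨hA, he⟩ := ha.of_step hF hG hb huv hh
    refine ⟨u, v, ⟨hA, fun a b hab => ?_⟩, by omega, huv⟩
    have := ht.2 a b hab
    omega

end

/-! ### Existence of a lowering domino move -/

section
variable {n : ℕ} {r : Fin 3 → ℕ} {X : Fin 3 → ZMod (4 * n)} {F G : SimpleGraph (ℤ × ℤ)}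
  {h k : ℤ → ℤ → ℤ}

/-- At two adjacent squares above `k`, a domino move lowers the height `h`. -/
def CanLower (n : ℕ) (α : ℤ) (F : SimpleGraph (ℤ × ℤ)) (h k : ℤ → ℤ → ℤ) : Prop :=
  ∃ x y x' y', Above n h k x y ∧ Above n h k x' y' ∧ ¬ (x' = x ∧ y' = y) ∧
    DominoMove n F (toggle (toggle F x y) x' y') ∧
    IsHeight n α (toggle (toggle F x y) x' y') (lower (lower h x y) x' y')

/-- An odd peak has unoccupied vertical edges, which needs a centre in the top arc and one in the
bottom arc. If the upper right side holds a single centre, it is the top one, the right arc is empty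
and the upper edge is forced: the move goes up. If the lower left side holds a single centre, the
left arc is empty and the move goes down. -/
theorem canLower_of_odd (bF : IsBundled n r X F) (bG : IsBundled n r X G)
    (hF : IsHeight n (X 0).val F h) (hG : IsHeight n (X 0).val G k) (hb : EqBoundary n h k)
    (hpar : ∀ x y, IsTop n h k x y → (x + y + (X 0).val) % 2 = 1)
    (hne : ∃ x y, IsTop n h k x y) : CanLower n (X 0).val F h k := by
  have range : ∀ x y, IsTop n h k x y → 0 ≤ x ∧ x ≤ n ∧ 0 ≤ y ∧ y ≤ n := fun x y ht =>
    ⟨ht.1.1, ht.1.2.1, ht.1.2.2.1, ht.1.2.2.2.1⟩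
  by_cases h1 : ∃ x y, IsTop n h k x y ∧ ∀ i j, UpperRight n x y ((X i).val + 1) →
      UpperRight n x y ((X j).val + 1) → i = j
  · obtain ⟨x, y, ⟨ht, hs⟩, hmax⟩ := exists_extremal (n := n) (fun _ y => y)
      (fun x y hQ => range x y hQ.1) h1
    have hp := ht.isPeak hF hG hb
    have hc := hpar x y ht
    obtain ⟨i1, i2, i3, i4⟩ := ht.1.interior hb
    have adj := hF.adj_of_isPeak hp i1 i2 i3 i4
    have fF := bF.forced_of_odd (x := x) (y := y) (by omega) i2 (by omega) i4 hc
    have fG := bG.forced_of_odd (x := x) (y := y) (by omega) i2 (by omega) i4 hc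
    obtain ⟨i, hi1, hi2⟩ : ∃ i, UpperLeft n x y ((X i).val + 1) ∧
        UpperRight n x y ((X i).val + 1) := by
      by_contra! hcon
      have := adj.2.2.1.1 (fF.2.2.1 hcon)
      omega
    have free : ∀ j, UpperRight n x y ((X j).val + 1) → UpperLeft n x y ((X j).val + 1) := by
      intro j hj
      rwa [hs j i hj hi2]
    have e := hF.sub_eq_of_horiz hG (x := x) (y := y + 1) (by omega) (by omega) (by omega)
      (by omega) (fF.1 free) (fG.1 free)
    rw [add_sub_cancel_right] at e
    have ha : Above n h k x (y + 1) := ⟨by omega, by omega, by omega, by omega, by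
      have := ht.1.2.2.2.2
      omega⟩
    have hi' := ha.interior hb
    rcases ht.isPeak_or_exists hF hG hb (by omega) ha with hp' | ⟨u, v, htu, hne', huv⟩
    · exact ⟨x, y, x, y + 1, ht.1, ha, by omega,
        hF.dominoMove_up hp hp' i1 i2 i3 (by omega) hc, (hF.toggle hp).toggle hp'⟩
    -- The other neighbours of `(x, y + 1)` have larger ordinate and no smaller `x + y`. Their upper
    -- right side is contained in that of `(x, y)`, so they satisfy the same condition, against the
    -- choice of `y` as maximal.
    · have := hmax u v ⟨htu, fun a b hA hB => hs a b (by simp only [UpperRight] at *; omega)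
        (by simp only [UpperRight] at *; omega)⟩
      omega
  -- Now every top square has at most one centre on its lower left side. Going down this side
  -- shrinks, so a top square of minimal ordinate is taken.
  · have h2 : ∃ x y, IsTop n h k x y ∧ ∀ i j, ¬ UpperRight n x y ((X i).val + 1) →
        ¬ UpperRight n x y ((X j).val + 1) → i = j := by
      obtain ⟨x, y, ht⟩ := hne
      exact ⟨x, y, ht, (subsingleton_or_compl _).resolve_left fun hs => h1 ⟨x, y, ht, hs⟩⟩
    obtain ⟨x, y, ⟨ht, hs⟩, hmax⟩ := exists_extremal (n := n) (fun _ y => -y)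
      (fun x y hQ => range x y hQ.1) h2
    have hp := ht.isPeak hF hG hb
    have hc := hpar x y ht
    obtain ⟨i1, i2, i3, i4⟩ := ht.1.interior hb
    have adj := hF.adj_of_isPeak hp i1 i2 i3 i4
    have fF := bF.forced_of_odd (x := x) (y := y) (by omega) i2 (by omega) i4 hc
    have fG := bG.forced_of_odd (x := x) (y := y) (by omega) i2 (by omega) i4 hc
    obtain ⟨i, hi1, hi2⟩ : ∃ i, ¬ UpperLeft n x y ((X i).val + 1) ∧
        ¬ UpperRight n x y ((X i).val + 1) := by
      by_contra! hcon
      have := adj.2.2.2.1 (fF.2.2.2 fun i => or_iff_not_imp_left.2 (hcon i))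
      omega
    have free : ∀ j, UpperLeft n x y ((X j).val + 1) → UpperRight n x y ((X j).val + 1) := by
      intro j hj
      by_contra hcon
      rw [hs j i hcon hi2] at hj
      exact hi1 hj
    have e := hF.sub_eq_of_horiz hG (x := x) (y := y) (by omega) (by omega) (by omega)
      (by omega) (fF.2.1 free) (fG.2.1 free)
    have ha : Above n h k x (y - 1) := ⟨by omega, by omega, by omega, by omega, by
      have := ht.1.2.2.2.2
      omega⟩
    have hi' := ha.interior hb
    rcases ht.isPeak_or_exists hF hG hb (by omega) ha with hp' | ⟨u, v, htu, hne', huv⟩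
    · refine ⟨x, y, x, y - 1, ht.1, ha, by omega, ?_, (hF.toggle hp).toggle hp'⟩
      have := hF.dominoMove_down (x := x) (y := y - 1) (by rwa [sub_add_cancel])
        (by rwa [sub_add_cancel]) i1 i2 (by omega) (by omega) (by omega)
      rwa [sub_add_cancel] at this
    · have := hmax u v ⟨htu, fun a b hA hB => hs a b (by simp only [UpperRight] at *; omega)
        (by simp only [UpperRight] at *; omega)⟩
      omega

/-- At an even peak the horizontal edges are unoccupied, so the right and the left arc contain
centres; the empty arc is the top or the bottom one, and the move goes right or left accordingly. -/
theorem canLower_of_even (bF : IsBundled n r X F) (bG : IsBundled n r X G)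
    (hF : IsHeight n (X 0).val F h) (hG : IsHeight n (X 0).val G k) (hb : EqBoundary n h k)
    (hpar : ∀ x y, IsTop n h k x y → (x + y + (X 0).val) % 2 = 0)
    (hne : ∃ x y, IsTop n h k x y) : CanLower n (X 0).val F h k := by
  have range : ∀ x y, IsTop n h k x y → 0 ≤ x ∧ x ≤ n ∧ 0 ≤ y ∧ y ≤ n := fun x y ht =>
    ⟨ht.1.1, ht.1.2.1, ht.1.2.2.1, ht.1.2.2.2.1⟩
  by_cases h1 : ∃ x y, IsTop n h k x y ∧ ∀ i j, UpperRight n x y ((X i).val + 2) →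
      UpperRight n x y ((X j).val + 2) → i = j
  · obtain ⟨x, y, ⟨ht, hs⟩, hmax⟩ := exists_extremal (n := n) (fun x _ => x)
      (fun x y hQ => range x y hQ.1) h1
    have hp := ht.isPeak hF hG hb
    have hc := hpar x y ht
    obtain ⟨i1, i2, i3, i4⟩ := ht.1.interior hb
    have adj := hF.adj_of_isPeak hp i1 i2 i3 i4
    have fF := bF.forced_of_even (x := x) (y := y) (by omega) i2 (by omega) i4 hc
    have fG := bG.forced_of_even (x := x) (y := y) (by omega) i2 (by omega) i4 hc
    obtain ⟨i, hi2, hi1⟩ : ∃ i, UpperRight n x y ((X i).val + 2) ∧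
        ¬ UpperLeft n x y ((X i).val + 2) := by
      by_contra! hcon
      have := adj.1.1 (fF.1 hcon)
      omega
    have free : ∀ j, UpperLeft n x y ((X j).val + 2) → ¬ UpperRight n x y ((X j).val + 2) := by
      intro j hj hcon
      rw [hs j i hcon hi2] at hj
      exact hi1 hj
    have e := hF.sub_eq_of_vert hG (x := x + 1) (y := y) (by omega) (by omega) (by omega)
      (by omega) (fF.2.2.1 free) (fG.2.2.1 free)
    rw [add_sub_cancel_right] at e
    have ha : Above n h k (x + 1) y := ⟨by omega, by omega, by omega, by omega, by
      have := ht.1.2.2.2.2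
      omega⟩
    have hi' := ha.interior hb
    rcases ht.isPeak_or_exists hF hG hb (by omega) ha with hp' | ⟨u, v, htu, hne', huv⟩
    · exact ⟨x, y, x + 1, y, ht.1, ha, by omega,
        hF.dominoMove_right hp hp' i1 (by omega) i3 i4 hc, (hF.toggle hp).toggle hp'⟩
    · have := hmax u v ⟨htu, fun a b hA hB => hs a b (by simp only [UpperRight] at *; omega)
        (by simp only [UpperRight] at *; omega)⟩
      omega
  · have h2 : ∃ x y, IsTop n h k x y ∧ ∀ i j, ¬ UpperRight n x y ((X i).val + 2) →
        ¬ UpperRight n x y ((X j).val + 2) → i = j := by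
      obtain ⟨x, y, ht⟩ := hne
      exact ⟨x, y, ht, (subsingleton_or_compl _).resolve_left fun hs => h1 ⟨x, y, ht, hs⟩⟩
    obtain ⟨x, y, ⟨ht, hs⟩, hmax⟩ := exists_extremal (n := n) (fun x _ => -x)
      (fun x y hQ => range x y hQ.1) h2
    have hp := ht.isPeak hF hG hb
    have hc := hpar x y ht
    obtain ⟨i1, i2, i3, i4⟩ := ht.1.interior hb
    have adj := hF.adj_of_isPeak hp i1 i2 i3 i4
    have fF := bF.forced_of_even (x := x) (y := y) (by omega) i2 (by omega) i4 hc
    have fG := bG.forced_of_even (x := x) (y := y) (by omega) i2 (by omega) i4 hc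
    obtain ⟨i, hi1, hi2⟩ : ∃ i, UpperLeft n x y ((X i).val + 2) ∧
        ¬ UpperRight n x y ((X i).val + 2) := by
      by_contra! hcon
      have := adj.2.1.1 (fF.2.1 hcon)
      omega
    have free : ∀ j, UpperLeft n x y ((X j).val + 2) ∨ UpperRight n x y ((X j).val + 2) := by
      intro j
      by_contra! hcon
      rw [hs j i hcon.2 hi2] at hcon
      exact hcon.1 hi1
    have e := hF.sub_eq_of_vert hG (x := x) (y := y) (by omega) (by omega) (by omega)
      (by omega) (fF.2.2.2 free) (fG.2.2.2 free)
    have ha : Above n h k (x - 1) y := ⟨by omega, by omega, by omega, by omega, by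
      have := ht.1.2.2.2.2
      omega⟩
    have hi' := ha.interior hb
    rcases ht.isPeak_or_exists hF hG hb (by omega) ha with hp' | ⟨u, v, htu, hne', huv⟩
    · refine ⟨x, y, x - 1, y, ht.1, ha, by omega, ?_, (hF.toggle hp).toggle hp'⟩
      have := hF.dominoMove_left (x := x - 1) (y := y) (by rwa [sub_add_cancel])
        (by rwa [sub_add_cancel]) (by omega) (by omega) i3 i4 (by omega)
      rwa [sub_add_cancel] at this
    · have := hmax u v ⟨htu, fun a b hA hB => hs a b (by simp only [UpperRight] at *; omega)
        (by simp only [UpperRight] at *; omega)⟩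
      omega

theorem canLower (bF : IsBundled n r X F) (bG : IsBundled n r X G)
    (hF : IsHeight n (X 0).val F h) (hG : IsHeight n (X 0).val G k) (hb : EqBoundary n h k)
    (hne : ∃ x y, Above n h k x y) : CanLower n (X 0).val F h k := by
  obtain ⟨x₀, y₀, ht₀⟩ : ∃ x y, IsTop n h k x y :=
    exists_extremal (n := n) h (fun x y ha => ⟨ha.1, ha.2.1, ha.2.2.1, ha.2.2.2.1⟩) hne
  -- All top squares have the same height, and the height determines the parity of the square.
  have par : ∀ x y, IsTop n h k x y → (x + y) % 2 = (x₀ + y₀) % 2 := by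
    intro x y ht
    have e1 := ht.2 _ _ ht₀.1
    have e2 := ht₀.2 _ _ ht.1
    have p1 := hF.parity x y ht.1.1 ht.1.2.1 ht.1.2.2.1 ht.1.2.2.2.1
    have p2 := hF.parity x₀ y₀ ht₀.1.1 ht₀.1.2.1 ht₀.1.2.2.1 ht₀.1.2.2.2.1
    omega
  by_cases hc : (x₀ + y₀ + (X 0).val) % 2 = 1
  · exact canLower_of_odd bF bG hF hG hb (fun x y ht => by have := par x y ht; omega)
      ⟨x₀, y₀, ht₀⟩
  · exact canLower_of_even bF bG hF hG hb (fun x y ht => by have := par x y ht; omega)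
      ⟨x₀, y₀, ht₀⟩

end

/-! ### Descent on the distance of heights -/

/-- The distance of two heights. -/
noncomputable def heightDist (n : ℕ) (h k : ℤ → ℤ → ℤ) : ℕ :=
  ∑ v ∈ Finset.Icc (0 : ℤ) n ×ˢ Finset.Icc (0 : ℤ) n, (h v.1 v.2 - k v.1 v.2).natAbs

theorem heightDist_comm (n : ℕ) (h k : ℤ → ℤ → ℤ) : heightDist n h k = heightDist n k h :=
  Finset.sum_congr rfl fun _ _ => by omega

theorem heightDist_lower {n : ℕ} {h k : ℤ → ℤ → ℤ} {x y : ℤ} (ha : Above n h k x y)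
    (h2 : k x y + 2 ≤ h x y) : heightDist n (lower h x y) k < heightDist n h k := by
  obtain ⟨h1, hxn, hy, hyn, hlt⟩ := ha
  refine Finset.sum_lt_sum (fun ⟨a, b⟩ _ => ?_) ⟨(x, y), ?_, ?_⟩
  · have l := lower_spec h x y a b
    by_cases hv : a = x ∧ b = y
    · obtain ⟨rfl, rfl⟩ := hv
      simp only
      omega
    · simp only
      omega
  · simp only [Finset.mem_product, Finset.mem_Icc]
    omega
  · have l := lower_spec h x y x y
    simp only
    omega

theorem EqBoundary.lower {n : ℕ} {h k : ℤ → ℤ → ℤ} (hb : EqBoundary n h k) {x y : ℤ}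
    (ha : Above n h k x y) : EqBoundary n (lower h x y) k := by
  intro a b ha1 ha2 hb1 hb2 hab
  have hi := ha.interior hb
  have l := lower_spec h x y a b
  rw [← hb a b ha1 ha2 hb1 hb2 hab]
  omega

theorem IsBundled.adj_outer_iff {n : ℕ} {r : Fin 3 → ℕ} {X : Fin 3 → ZMod (4 * n)}
    {F G : SimpleGraph (ℤ × ℤ)} (bF : IsBundled n r X F) (bG : IsBundled n r X G) {o v : ℤ × ℤ}
    (ho : ¬ IsGridVertex n o) : F.Adj o v ↔ G.Adj o v := by
  have hsum := bF.sum
  have hpos := bF.pos 0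
  have : NeZero (4 * n) := ⟨by omega⟩
  have key : ∀ {F G : SimpleGraph (ℤ × ℤ)}, IsBundled n r X F → IsBundled n r X G → F.Adj o v →
      G.Adj o v := by
    intro F G bF bG hF
    have hbd := bF.isFPL.le_board hF
    obtain ⟨k, -, rfl⟩ := exists_eq_outer ho hbd
    have hα : (((X 0).val : ℤ) : ZMod (4 * n)) = X 0 := by simp
    obtain ⟨w, hw⟩ : Occupied n G ((k : ℤ) : ZMod (4 * n)) := by
      rw [bG.occupied_iff hα, ← bF.occupied_iff hα]
      exact ⟨v, by simpa using hF⟩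
    rw [Int.cast_natCast] at hw
    rwa [isLeaf_of_le_board le_rfl ho _ _ hbd (bG.isFPL.le_board hw)]
  exact ⟨key bF bG, key bG bF⟩

theorem exists_lower_dist {n : ℕ} {α : ℤ} {F G : SimpleGraph (ℤ × ℤ)} {h k : ℤ → ℤ → ℤ}
    (hF : IsHeight n α F h) (hG : IsHeight n α G k) (hb : EqBoundary n h k)
    (hl : CanLower n α F h k) : ∃ F' h', DominoMove n F F' ∧ IsHeight n α F' h' ∧
      EqBoundary n h' k ∧ heightDist n h' k < heightDist n h k := by
  obtain ⟨x, y, x', y', ha, ha', hne, hm, hh⟩ := hl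
  -- The two heights are congruent modulo two, so an excess is at least two and lowering does not
  -- overshoot.
  have even : ∀ x y, Above n h k x y → k x y + 2 ≤ h x y := by
    rintro x y ⟨h1, h2, h3, h4, h5⟩
    have := hF.parity x y h1 h2 h3 h4
    have := hG.parity x y h1 h2 h3 h4
    omega
  have e : lower h x y x' y' = h x' y' := by
    have := lower_spec h x y x' y'
    omega
  have ha'' : Above n (lower h x y) k x' y' := by
    obtain ⟨h1, h2, h3, h4, h5⟩ := ha'
    exact ⟨h1, h2, h3, h4, by omega⟩
  refine ⟨_, _, hm, hh, (hb.lower ha).lower ha'', (heightDist_lower ha'' ?_).trans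
    (heightDist_lower ha (even x y ha))⟩
  rw [e]
  exact even x' y' ha'

/-- If `h` exceeds `k` somewhere, a move is made at the `F` end. If only `k` exceeds `h`, the move
is made at the `G` end and appended in reverse. Otherwise the heights agree, and they determine the
configuration. -/
theorem reflTransGen_dominoMove {n a b c : ℕ} {A B C : ZMod (4 * n)} {r : Fin 3 → ℕ}
    {X : Fin 3 → ZMod (4 * n)} (hX : ∀ F, IsOfType n a b c A B C F → IsBundled n r X F) (N : ℕ) :
    ∀ (F G : SimpleGraph (ℤ × ℤ)) (h k : ℤ → ℤ → ℤ), IsOfType n a b c A B C F →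
      IsOfType n a b c A B C G → IsHeight n (X 0).val F h → IsHeight n (X 0).val G k →
      EqBoundary n h k → heightDist n h k = N → Relation.ReflTransGen (DominoMove n) F G := by
  induction N using Nat.strong_induction_on with
  | _ N ih =>
    intro F G h k tF tG hF hG hb hN
    have hb' : EqBoundary n k h := fun x y h1 h2 h3 h4 h5 => (hb x y h1 h2 h3 h4 h5).symm
    by_cases h1 : ∃ x y, Above n h k x y
    · obtain ⟨F', h', hm, hF', hbF', hlt⟩ := exists_lower_dist hF hG hb
        (canLower (hX F tF) (hX G tG) hF hG hb h1)
      exact .head hm (ih _ (hN ▸ hlt) F' G h' k (hm.isOfType tF) tG hF' hG hbF' rfl)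
    by_cases h2 : ∃ x y, Above n k h x y
    · obtain ⟨G', k', hm, hG', hbG', hlt⟩ := exists_lower_dist hG hF hb'
        (canLower (hX G tG) (hX F tF) hG hF hb' h2)
      rw [heightDist_comm n k' h, heightDist_comm n k h] at hlt
      exact .tail (ih _ (hN ▸ hlt) F G' h k' tF (hm.isOfType tG) hF hG'
        (fun x y h1 h2 h3 h4 h5 => (hbG' x y h1 h2 h3 h4 h5).symm) rfl) hm.symm
    · have : F = G := hF.eq_of_eq hG tF.isFPL.le_board tG.isFPL.le_board fun x y g1 g2 g3 g4 => by
        by_contra hne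
        rcases lt_or_gt_of_ne hne with hlt | hlt
        · exact h2 ⟨x, y, g1, g2, g3, g4, hlt⟩
        · exact h1 ⟨x, y, g1, g2, g3, g4, hlt⟩
      rw [this]

end FPL

theorem corollary1 (n a b c : ℕ) (ha : 0 < a) (hb : 0 < b) (hc : 0 < c) (hn : a + b + c = n)
    (A B C : ZMod (4 * n)) (hABC : FPL.AreCentres n a b c A B C) :
    (∀ F G : SimpleGraph (ℤ × ℤ), FPL.IsOfType n a b c A B C F → FPL.DominoMove n F G →
      FPL.IsOfType n a b c A B C G) ∧
    (∀ F G : SimpleGraph (ℤ × ℤ), FPL.IsOfType n a b c A B C F → FPL.IsOfType n a b c A B C G →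
      Relation.ReflTransGen (FPL.DominoMove n) F G) := by
  refine ⟨fun F G tF hm => hm.isOfType tF, fun F G tF tG => ?_⟩
  obtain ⟨r, X, hX⟩ := hABC.exists_isBundled ha hb hc hn
  -- The same parity reference `X 0` and the same value at the corner square serve both
  -- configurations, so their equal external edges give equal boundary heights.
  obtain ⟨h, hF, h0⟩ := FPL.exists_isHeight tF.isFPL.le_board tF.isFPL.two_edges (X 0).val
  obtain ⟨k, hG, k0⟩ := FPL.exists_isHeight tG.isFPL.le_board tG.isFPL.two_edges (X 0).val
  exact FPL.reflTransGen_dominoMove hX _ F G h k tF tG hF hG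
    (fun x y h1 h2 h3 h4 h5 => hF.eq_boundary hG (h0.trans k0.symm)
      (fun o v ho => (hX F tF).adj_outer_iff (hX G tG) ho) h1 h2 h3 h4 h5) rfl
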